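/- Let $b\in\mathbb C$ with $\operatorname{Re} b>-1/2$ and consider on the unit circle $\mathbb T$ the modified Jacobi weight $$\nu(z)=(-z)^{-\overline b}(1-z)^{b+\overline b}\quad\text{(principal powers)},\qquad d\mu(z)=\frac{\nu(z)}{iz}\,dz .$$ There are a unique sequence of monic polynomials $\Phi_n$ with $\deg\Phi_n=n$ and unique numbers $\kappa_n>0$ ($n\ge 0$) such that $\int_{\mathbb T}\Phi_n\overline{\Phi_m}\,d\mu=\kappa_n^{-2}\delta_{n,m}$. Put $\Phi_n^*(z)=z^n\overline{\Phi_n(1/\overline z)}$, $\alpha_{n-1}=-\overline{\Phi_n(0)}$ (so $\alpha_{-1}=-1$), $b_n=2\pi\kappa_n^2$, let $\Phi_1^n$ be the coefficient of $z^{n-1}$ in $\Phi_n$, and for $|z|\neq 1$ let $$G_n(z)=\frac1{2\pi i}\int_{\mathbb T}\frac{\Phi_n(t)}{t-z}\frac{\nu(t)}{t^n}\,dt,\qquad G_{n-1}^*(z)=\frac1{2\pi i}\int_{\mathbb T}\frac{\Phi_{n-1}^*(t)}{t-z}\frac{\nu(t)}{t^n}\,dt,\qquad Y_n=\begin{bmatrix}\Phi_n&G_n\\-b_{n-1}\Phi_{n-1}^*&-b_{n-1}G_{n-1}^*\end{bmatrix}.$$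 Let $C_n(z)=\operatorname{diag}\big(z^{-n/2}\nu(z)^{1/2},\,z^{n/2}\nu(z)^{-1/2}\big)$, where $\nu(z)=(-z)^{-\overline b}(1-z)^{b+\overline b}$ and the square roots are any holomorphic branches on an open set $U\subset\mathbb C\setminus\mathbb T$ with $0\notin U$; let $Z_n=Y_nC_n$ and $M_n=Z_n'Z_n^{-1}$ on $U$. Then for every $n\ge 1$ the following hold. (i) $G_n$ and $G^*_{n-1}$ are holomorphic in $\mathbb C\setminus\mathbb T$, and $\det Y_n=1$ there. (ii) For every such $U$, every choice of branches and every $z\in U$, $$z(1-z)M_n(z)=\begin{bmatrix}-\frac{(b+n)z+(\overline b+n)(2|\alpha_{n-1}|^2-1)}2&-b_n^{-1}(\overline b+n)\overline{\alpha_{n-1}}\\-b_{n-1}(\overline b+n)\alpha_{n-1}&\frac{(b+n)z+(\overline b+n)(2|\alpha_{n-1}|^2-1)}2\end{bmatrix}$$ and also $$z(1-z)M_n(z)=\begin{bmatrix}-\frac{(b+n)z+(\overline b-n)}2+\Phi_1^n&-(b+n+1)b_n^{-1}\overline{\alpha_n}\\-(b+n-1)b_{n-1}\alpha_{n-2}&\frac{(b+n)z+(\overline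 b-n)}2-\Phi_1^n\end{bmatrix}.$$ (iii) $\displaystyle \Phi_1^n=\overline b-(\overline b+n)|\alpha_{n-1}|^2$ and $\displaystyle \alpha_n=\frac{b+n}{\overline b+n+1}\,\alpha_{n-1}$. (iv) For all $z\in\mathbb C$ in the relations for the polynomials, and all $z\in\mathbb C\setminus\mathbb T$ in those for $G_n$ and $G_{n-1}^*$, \begin{align*} z(1-z)\Phi_n'(z)&=\big(-nz+(\overline b+n)(1-|\alpha_{n-1}|^2)\big)\Phi_n(z)+(\overline b+n)(1-|\alpha_{n-1}|^2)\overline{\alpha_{n-1}}\,\Phi_{n-1}^*(z),\\ z(1-z)G_n'(z)&=\big(-bz-(\overline b+n)|\alpha_{n-1}|^2\big)G_n(z)+(\overline b+n)(1-|\alpha_{n-1}|^2)\overline{\alpha_{n-1}}\,G_{n-1}^*(z),\\ z(1-z)(\Phi_{n-1}^*)'(z)&=\big(bz+(\overline b+n)|\alpha_{n-1}|^2\big)\Phi_{n-1}^*(z)+(\overline b+n)\alpha_{n-1}\Phi_n(z),\\ z(1-z)(G_{n-1}^*)'(z)&=\big(nz-(\overline b+n)(1-|\alpha_{n-1}|^2)\big)G_{n-1}^*(z)+(\overline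 b+n)\alpha_{n-1}G_n(z),\\ (z-1)\Phi_n'(z)&=-(\overline b+n)(1-|\alpha_{n-1}|^2)\Phi_{n-1}(z)+n\Phi_n(z). \end{align*} -/

import Mathlib

noncomputable section

namespace JacobiOPUC

open Complex Polynomial ComplexConjugate

/-- The modified Jacobi weight `ν(z) = (-z)^{-b̄} (1-z)^{b+b̄}` on the unit circle (principal
powers). With `b = λ + iη` and `z = e^{iθ}`, `0 < θ < 2π`, it equals
`e^{η(π-θ)} (4 sin²(θ/2))^λ`. -/
def nu (b z : ℂ) : ℂ := (-z) ^ (-conj b) * (1 - z) ^ (b + conj b)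

/-- `∫_𝕋 p(z) conj(q(z)) dμ(z)` with `dμ(z) = ν(z) / (i z) dz`. -/
def pairing (b : ℂ) (p q : ℂ[X]) : ℂ :=
  ∮ z in C(0, 1), p.eval z * conj (q.eval z) * (nu b z / (I * z))

/-- `Φ` is the sequence of monic orthogonal polynomials of the weight, with
`∫ Φ_n conj(Φ_m) dμ = κ_n⁻² δ_{nm}`, `κ_n > 0`. -/
structure IsMonicOrthogonal (b : ℂ) (Φ : ℕ → ℂ[X]) (κ : ℕ → ℝ) : Prop where
  monic : ∀ n, (Φ n).Monic
  natDegree_eq : ∀ n, (Φ n).natDegree = n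
  kappa_pos : ∀ n, 0 < κ n
  orthogonal : ∀ n m, n ≠ m → pairing b (Φ n) (Φ m) = 0
  norm_sq : ∀ n, pairing b (Φ n) (Φ n) = (((κ n ^ 2)⁻¹ : ℝ) : ℂ)

/-- The reciprocal polynomial `Φ_n^*(z) = z^n conj(Φ_n(1 / conj z))`. -/
def recip (Φ : ℕ → ℂ[X]) (n : ℕ) : ℂ[X] := ((Φ n).map (starRingEnd ℂ)).reflect n

/-- The Verblunsky coefficients `α_k = -conj(Φ_{k+1}(0))`, `k ≥ -1` (so `α_{-1} = -1`). -/
def alpha (Φ : ℕ → ℂ[X]) (k : ℤ) : ℂ := -conj ((Φ (k + 1).toNat).eval 0)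

/-- The constants `b_n = 2π κ_n²`. -/
def bconst (κ : ℕ → ℝ) (n : ℕ) : ℂ := ((2 * Real.pi * κ n ^ 2 : ℝ) : ℂ)

/-- `G_n(z) = (1/2πi) ∫_𝕋 Φ_n(t)/(t-z) ν(t)/t^n dt`. -/
def G (b : ℂ) (Φ : ℕ → ℂ[X]) (n : ℕ) (z : ℂ) : ℂ :=
  (2 * Real.pi * I)⁻¹ * ∮ t in C(0, 1), (Φ n).eval t / (t - z) * (nu b t / t ^ n)

/-- `G_k^*(z) = (1/2πi) ∫_𝕋 Φ_k^*(t)/(t-z) ν(t)/t^{k+1} dt`. -/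
def Gstar (b : ℂ) (Φ : ℕ → ℂ[X]) (k : ℕ) (z : ℂ) : ℂ :=
  (2 * Real.pi * I)⁻¹ * ∮ t in C(0, 1), (recip Φ k).eval t / (t - z) * (nu b t / t ^ (k + 1))

/-- The matrix `Y_n` solving the Riemann-Hilbert problem (used for `n ≥ 1`). -/
def Y (b : ℂ) (Φ : ℕ → ℂ[X]) (κ : ℕ → ℝ) (n : ℕ) (z : ℂ) : Matrix (Fin 2) (Fin 2) ℂ :=
  !![(Φ n).eval z, G b Φ n z;
     -bconst κ (n - 1) * (recip Φ (n - 1)).eval z, -bconst κ (n - 1) * Gstar b Φ (n - 1) z]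

/-- A choice, on a set `U`, of holomorphic branches of the multivalued functions
`ν(z)^{1/2}` and `z^{n/2}`: here `logNeg` and `logOneSub` are logarithms of `-z` and `1 - z`,
and `ν(z) = exp(-b̄ log(-z) + (b+b̄) log(1-z))` is the corresponding branch of the weight. -/
structure Branch (b : ℂ) (n : ℕ) (U : Set ℂ) where
  logNeg : ℂ → ℂ
  logOneSub : ℂ → ℂ
  sqrtNu : ℂ → ℂ
  powHalf : ℂ → ℂ
  logNeg_holo : DifferentiableOn ℂ logNeg U
  logOneSub_holo : DifferentiableOn ℂ logOneSub U
  sqrtNu_holo : DifferentiableOn ℂ sqrtNu U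
  powHalf_holo : DifferentiableOn ℂ powHalf U
  exp_logNeg : ∀ z ∈ U, exp (logNeg z) = -z
  exp_logOneSub : ∀ z ∈ U, exp (logOneSub z) = 1 - z
  sqrtNu_sq : ∀ z ∈ U, sqrtNu z ^ 2 = exp (-conj b * logNeg z + (b + conj b) * logOneSub z)
  powHalf_sq : ∀ z ∈ U, powHalf z ^ 2 = z ^ n

/-- Branches exist near every point other than `0` and `1`. -/
theorem exists_branch (b : ℂ) (n : ℕ) (z₀ : ℂ) (h0 : z₀ ≠ 0) (h1 : z₀ ≠ 1) :
    ∃ U : Set ℂ, IsOpen U ∧ z₀ ∈ U ∧ Nonempty (Branch b n U) := by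
  have h1' : 1 - z₀ ≠ 0 := sub_ne_zero.mpr (Ne.symm h1)
  let U : Set ℂ := {z | z / z₀ ∈ slitPlane} ∩ {z | (1 - z) / (1 - z₀) ∈ slitPlane}
  let L : ℂ → ℂ := fun z => log (z / z₀) + log (-z₀)
  let K : ℂ → ℂ := fun z => log ((1 - z) / (1 - z₀)) + log (1 - z₀)
  have hL : DifferentiableOn ℂ L U := fun z hz =>
    ((DifferentiableAt.clog (f := fun z => z / z₀) (by fun_prop) hz.1).add_const _).differentiableWithinAt
  have hK : DifferentiableOn ℂ K U := fun z hz =>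
    ((DifferentiableAt.clog (f := fun z => (1 - z) / (1 - z₀)) (by fun_prop)
      hz.2).add_const _).differentiableWithinAt
  have eL : ∀ z ∈ U, exp (L z) = -z := by
    intro z hz
    simp only [L]
    rw [exp_add, exp_log (slitPlane_ne_zero hz.1), exp_log (neg_ne_zero.mpr h0)]
    field_simp
  have eK : ∀ z ∈ U, exp (K z) = 1 - z := by
    intro z hz
    simp only [K]
    rw [exp_add, exp_log (slitPlane_ne_zero hz.2), exp_log h1']
    field_simp
  refine ⟨U, ?_, ?_, ⟨⟨L, K, fun z => exp ((-conj b * L z + (b + conj b) * K z) / 2),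
    fun z => exp (n * (L z + Real.pi * I) / 2), hL, hK, ?_, ?_, eL, eK, ?_, ?_⟩⟩⟩
  · exact (isOpen_slitPlane.preimage (by fun_prop)).inter
      (isOpen_slitPlane.preimage (by fun_prop))
  · exact ⟨by simp [h0], by simp [h1']⟩
  · fun_prop
  · fun_prop
  · intro z _
    rw [← exp_nat_mul]
    congr 1
    push_cast
    ring
  · intro z hz
    rw [← exp_nat_mul]
    have : ((2 : ℕ) : ℂ) * (n * (L z + Real.pi * I) / 2) = n * (L z + Real.pi * I) := by
      push_cast
      ring
    rw [this, exp_nat_mul, exp_add, eL z hz, exp_pi_mul_I]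
    simp

/-- `C_n(z) = diag(z^{-n/2} ν(z)^{1/2}, z^{n/2} ν(z)^{-1/2})` for the given branches. -/
def Branch.C {b : ℂ} {n : ℕ} {U : Set ℂ} (β : Branch b n U) (z : ℂ) :
    Matrix (Fin 2) (Fin 2) ℂ :=
  !![β.sqrtNu z / β.powHalf z, 0; 0, β.powHalf z / β.sqrtNu z]

/-- The constant jump fundamental matrix `Z_n = Y_n C_n`. -/
def Z {b : ℂ} {n : ℕ} {U : Set ℂ} (β : Branch b n U) (Φ : ℕ → ℂ[X]) (κ : ℕ → ℝ) (z : ℂ) :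
    Matrix (Fin 2) (Fin 2) ℂ :=
  Y b Φ κ n z * β.C z

/-- The structure matrix `M_n = Z_n' Z_n⁻¹`, with `Z_n'` the entrywise derivative. -/
def M {b : ℂ} {n : ℕ} {U : Set ℂ} (β : Branch b n U) (Φ : ℕ → ℂ[X]) (κ : ℕ → ℝ) (z : ℂ) :
    Matrix (Fin 2) (Fin 2) ℂ :=
  (Matrix.of fun i j => deriv (fun w => Z β Φ κ w i j) z) * (Z β Φ κ z)⁻¹

end JacobiOPUC

end

/-!
On the circle the weight satisfies a Pearson equation: integrating by parts against `μ` turns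
`(1 - t) t g'(t)` into `((b + 1) t + b̄) g(t)`. Hence `(z - 1) Φ_n' - n Φ_n`, of degree less than
`n`, is orthogonal to `1, …, z^{n-2}`, and `z (1 - z) (Φ_{n-1}^*)' - b z Φ_{n-1}^*`, of degree at
most `n`, is orthogonal to `z, …, z^{n-1}`. The former is therefore a multiple of `Φ_{n-1}` and the
latter a combination of `Φ_n` and `Φ_{n-1}^*`, with coefficients read off from Szegő's recurrence.
Up to constants `G_n` and `G_{n-1}^*` are Cauchy transforms, and the same integration by parts
carries the relations over to them. Together they say `z (1 - z) Y' = S Y - Y D` with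
`D = z (1 - z) C' C⁻¹`, so that `Z = Y C` satisfies `z (1 - z) Z' = S Z`.
-/

noncomputable section

namespace JacobiOPUC

open Complex Polynomial ComplexConjugate MeasureTheory Set

section CircleInner

instance : MeasurableSpace Circle := borel Circle

instance : BorelSpace Circle := ⟨rfl⟩

theorem conj_coe_circle (t : Circle) : conj (t : ℂ) = (t : ℂ)⁻¹ := by
  rw [← Circle.coe_inv_eq_conj, Circle.coe_inv]

/-- A measure on the circle is nontrivial if it is not concentrated on finitely many points, so
that it does not annihilate the square of a nonzero polynomial. -/
class IsNontrivialMeasure (μ : Measure Circle) : Prop where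
  measure_compl_ne_zero : ∀ s : Set Circle, s.Finite → μ sᶜ ≠ 0

variable (μ : Measure Circle)

theorem integrable_of_continuous [IsFiniteMeasure μ] {f : Circle → ℂ} (hf : Continuous f) :
    Integrable f μ :=
  hf.integrable_of_hasCompactSupport (.of_compactSpace f)

variable [IsFiniteMeasure μ]

/-- The sesquilinear form `⟨p, q⟩ = ∫ p(t) conj(q(t)) dμ(t)` on polynomials, linear in the first
argument and conjugate linear in the second. -/
def circleInner : ℂ[X] →ₗ[ℂ] ℂ[X] →ₗ⋆[ℂ] ℂ :=
  LinearMap.mk₂'ₛₗ (RingHom.id ℂ) (starRingEnd ℂ)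
    (fun p q => ∫ t : Circle, p.eval (t : ℂ) * conj (q.eval (t : ℂ)) ∂μ)
    (fun p₁ p₂ q => by
      simp only [eval_add, add_mul]
      exact integral_add (integrable_of_continuous μ (by fun_prop))
        (integrable_of_continuous μ (by fun_prop)))
    (fun c p q => by
      simp only [eval_smul, smul_eq_mul, mul_assoc, integral_const_mul, RingHom.id_apply])
    (fun p q₁ q₂ => by
      simp only [eval_add, map_add, mul_add]
      exact integral_add (integrable_of_continuous μ (by fun_prop))
        (integrable_of_continuous μ (by fun_prop)))
    (fun c p q => by
      simp only [eval_smul, smul_eq_mul, map_mul, mul_left_comm _ (conj c), integral_const_mul])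

theorem circleInner_apply (p q : ℂ[X]) :
    circleInner μ p q = ∫ t : Circle, p.eval (t : ℂ) * conj (q.eval (t : ℂ)) ∂μ :=
  rfl

theorem conj_circleInner (p q : ℂ[X]) : conj (circleInner μ p q) = circleInner μ q p := by
  simp only [circleInner_apply, ← integral_conj, map_mul, conj_conj, mul_comm]

theorem circleInner_X_mul_X_mul (p q : ℂ[X]) :
    circleInner μ (X * p) (X * q) = circleInner μ p q := by
  simp only [circleInner_apply, eval_mul, eval_X, map_mul, conj_coe_circle]
  refine integral_congr_ae (.of_forall fun t => ?_)
  have ht : (t : ℂ) ≠ 0 := t.coe_ne_zero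
  field_simp

theorem circleInner_X_mul_X_pow_succ (p : ℂ[X]) (j : ℕ) :
    circleInner μ (X * p) (X ^ (j + 1)) = circleInner μ p (X ^ j) := by
  rw [pow_succ', circleInner_X_mul_X_mul]

theorem circleInner_X_pow (p : ℂ[X]) (j : ℕ) :
    circleInner μ p (X ^ j) = ∫ t : Circle, p.eval (t : ℂ) * ((t : ℂ) ^ j)⁻¹ ∂μ := by
  simp only [circleInner_apply, eval_pow, eval_X, map_pow, conj_coe_circle, inv_pow]

theorem circleInner_self (p : ℂ[X]) :
    circleInner μ p p = ((∫ t : Circle, ‖p.eval (t : ℂ)‖ ^ 2 ∂μ : ℝ) : ℂ) := by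
  simp only [circleInner_apply, mul_conj', ← ofReal_pow, integral_complex_ofReal]

theorem circleInner_eq_zero_of_coeff {p q : ℂ[X]}
    (h : ∀ j, q.coeff j ≠ 0 → circleInner μ p (X ^ j) = 0) : circleInner μ p q = 0 := by
  rw [q.as_sum_support, map_sum]
  refine Finset.sum_eq_zero fun j hj => ?_
  rw [← smul_X_eq_monomial, LinearMap.map_smulₛₗ, h j (mem_support_iff.mp hj), smul_zero]

theorem integral_norm_eval_sq_pos [IsNontrivialMeasure μ] {p : ℂ[X]} (hp : p ≠ 0) :
    0 < ∫ t : Circle, ‖p.eval (t : ℂ)‖ ^ 2 ∂μ := by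
  have hint : Integrable (fun t : Circle => ‖p.eval (t : ℂ)‖ ^ 2) μ :=
    Continuous.integrable_of_hasCompactSupport (by fun_prop) (.of_compactSpace _)
  rw [integral_pos_iff_support_of_nonneg (fun t => sq_nonneg _) hint, pos_iff_ne_zero]
  have hroots : {t : Circle | p.eval (t : ℂ) = 0}.Finite :=
    (p.rootSet_finite ℂ).preimage Circle.coe_injective.injOn |>.subset fun t ht =>
      (mem_rootSet_of_ne hp).mpr (by rwa [coe_aeval_eq_eval])
  convert IsNontrivialMeasure.measure_compl_ne_zero (μ := μ) _ hroots using 2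
  ext t
  simp

variable {μ}

theorem circleInner_self_ne_zero [IsNontrivialMeasure μ] {p : ℂ[X]} (hp : p ≠ 0) :
    circleInner μ p p ≠ 0 := by
  rw [circleInner_self, ofReal_ne_zero]
  exact (integral_norm_eval_sq_pos μ hp).ne'

theorem eq_zero_of_circleInner_X_pow [IsNontrivialMeasure μ] {p : ℂ[X]}
    (h : ∀ j, p.coeff j ≠ 0 → circleInner μ p (X ^ j) = 0) : p = 0 := by
  contrapose! h
  by_contra! hj
  exact circleInner_self_ne_zero h (circleInner_eq_zero_of_coeff μ fun j => hj j)

end CircleInner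

section ConjReflect

/-- The reversed polynomial `zⁿ conj(p(1 / conj z))` of a polynomial `p` of degree at most `n`;
thus `recip Φ n` is `conjReflect n (Φ n)`. -/
def conjReflect (n : ℕ) (p : ℂ[X]) : ℂ[X] :=
  (p.map (starRingEnd ℂ)).reflect n

variable {n : ℕ} {p q : ℂ[X]}

theorem coeff_conjReflect (p : ℂ[X]) {j : ℕ} (hj : j ≤ n) :
    (conjReflect n p).coeff j = conj (p.coeff (n - j)) := by
  rw [conjReflect, coeff_reflect, revAt_le hj, coeff_map]

theorem natDegree_conjReflect_le (hp : p.natDegree ≤ n) : (conjReflect n p).natDegree ≤ n :=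
  natDegree_le_iff_coeff_eq_zero.mpr fun j hj => by
    rw [conjReflect, coeff_reflect, revAt_eq_self_of_lt hj, coeff_map,
      coeff_eq_zero_of_natDegree_lt (hp.trans_lt hj), map_zero]

theorem conjReflect_X_pow {j : ℕ} (hj : j ≤ n) : conjReflect n (X ^ j) = X ^ (n - j) := by
  rw [conjReflect, Polynomial.map_pow, map_X, reflect_monomial, revAt_le hj]

theorem conjReflect_X_mul (hp : p.natDegree ≤ n) :
    conjReflect (n + 1) (X * p) = conjReflect n p := by
  rw [conjReflect, Polynomial.map_mul, map_X, add_comm n, reflect_mul _ _ natDegree_X_le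
    (natDegree_map_le.trans hp), ← pow_one X, reflect_monomial, revAt_le le_rfl, Nat.sub_self,
    pow_zero, one_mul, conjReflect]

theorem eval_conjReflect (hp : p.natDegree ≤ n) (t : Circle) :
    (conjReflect n p).eval (t : ℂ) = (t : ℂ) ^ n * conj (p.eval (t : ℂ)) := by
  have ht : (t : ℂ) ≠ 0 := t.coe_ne_zero
  let : Invertible (t : ℂ)⁻¹ := invertibleOfNonzero (inv_ne_zero ht)
  have h := eval₂_reflect_mul_pow (RingHom.id ℂ) (t : ℂ)⁻¹ n (p.map (starRingEnd ℂ))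
    (natDegree_map_le.trans hp)
  have hconj : eval (conj (t : ℂ)) (p.map (starRingEnd ℂ)) = conj (p.eval (t : ℂ)) := by
    rw [eval_map, eval₂_hom]
  rw [invOf_eq_inv, inv_inv, eval₂_id, eval₂_id, ← conj_coe_circle, hconj, conj_coe_circle] at h
  rw [← h, conjReflect, inv_pow]
  field_simp

variable {μ : Measure Circle} [IsFiniteMeasure μ]

theorem circleInner_conjReflect_conjReflect (hp : p.natDegree ≤ n) (hq : q.natDegree ≤ n) :
    circleInner μ (conjReflect n p) (conjReflect n q) = circleInner μ q p := by
  simp only [circleInner_apply, eval_conjReflect hp, eval_conjReflect hq, map_mul, map_pow,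
    conj_conj, conj_coe_circle, inv_pow]
  refine integral_congr_ae (.of_forall fun t => ?_)
  have ht : (t : ℂ) ≠ 0 := t.coe_ne_zero
  field_simp

theorem circleInner_conjReflect_X_pow (hp : p.natDegree ≤ n) {j : ℕ} (hj : j ≤ n) :
    circleInner μ (conjReflect n p) (X ^ j) = conj (circleInner μ p (X ^ (n - j))) := by
  rw [conj_circleInner, ← circleInner_conjReflect_conjReflect hp (by simp),
    conjReflect_X_pow (Nat.sub_le n j), Nat.sub_sub_self hj]

theorem circleInner_mul_X_pow (p : ℂ[X]) (hq : q.natDegree ≤ n) :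
    circleInner μ (p * q) (X ^ n) = circleInner μ p (conjReflect n q) := by
  simp only [circleInner_apply, eval_conjReflect hq, eval_mul, eval_pow, eval_X, map_mul, map_pow,
    conj_conj]
  exact integral_congr_ae (.of_forall fun t => by ring)

end ConjReflect

section Orthogonality

/-- `p` is the monic orthogonal polynomial of degree `n` of the measure `μ` on the circle. -/
structure IsOrthogonalMonic (μ : Measure Circle) [IsFiniteMeasure μ] (n : ℕ) (p : ℂ[X]) :
    Prop where
  monic : p.Monic
  natDegree_eq : p.natDegree = n
  circleInner_X_pow : ∀ j < n, circleInner μ p (X ^ j) = 0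

variable {μ : Measure Circle} [IsFiniteMeasure μ] {n : ℕ} {p q : ℂ[X]}

namespace IsOrthogonalMonic

theorem coeff_self (hp : IsOrthogonalMonic μ n p) : p.coeff n = 1 := by
  simpa [hp.natDegree_eq] using hp.monic.coeff_natDegree

theorem circleInner_eq_zero (hp : IsOrthogonalMonic μ n p) (hq : q.natDegree < n) :
    circleInner μ p q = 0 :=
  circleInner_eq_zero_of_coeff μ fun j hj =>
    hp.circleInner_X_pow j ((le_natDegree_of_ne_zero hj).trans_lt hq)

theorem circleInner_of_natDegree_le (hp : IsOrthogonalMonic μ n p) (hq : q.natDegree ≤ n) :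
    circleInner μ p q = conj (q.coeff n) * circleInner μ p (X ^ n) := by
  have hzero : circleInner μ p (q - q.coeff n • X ^ n) = 0 := by
    refine circleInner_eq_zero_of_coeff μ fun j hj => hp.circleInner_X_pow j ?_
    contrapose! hj
    rcases hj.eq_or_lt with rfl | hnj
    · simp
    · simp [coeff_X_pow, hnj.ne', coeff_eq_zero_of_natDegree_lt (hq.trans_lt hnj)]
  rwa [map_sub, LinearMap.map_smulₛₗ, smul_eq_mul, sub_eq_zero] at hzero

theorem circleInner_X_pow_self (hp : IsOrthogonalMonic μ n p) :
    circleInner μ p (X ^ n) = circleInner μ p p := by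
  rw [hp.circleInner_of_natDegree_le hp.natDegree_eq.le, hp.coeff_self, map_one, one_mul]

theorem coeff_zero_conjReflect (hp : IsOrthogonalMonic μ n p) :
    (conjReflect n p).coeff 0 = 1 := by
  rw [coeff_conjReflect p n.zero_le, Nat.sub_zero, hp.coeff_self, map_one]

theorem natDegree_conjReflect_le (hp : IsOrthogonalMonic μ n p) :
    (conjReflect n p).natDegree ≤ n :=
  JacobiOPUC.natDegree_conjReflect_le hp.natDegree_eq.le

theorem circleInner_conjReflect_X_pow (hp : IsOrthogonalMonic μ n p) {j : ℕ} (hj : 1 ≤ j)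
    (hjn : j ≤ n) : circleInner μ (conjReflect n p) (X ^ j) = 0 := by
  rw [JacobiOPUC.circleInner_conjReflect_X_pow hp.natDegree_eq.le hjn,
    hp.circleInner_X_pow _ (by omega), map_zero]

theorem circleInner_conjReflect_one (hp : IsOrthogonalMonic μ n p) :
    circleInner μ (conjReflect n p) 1 = circleInner μ p p := by
  rw [← pow_zero X, JacobiOPUC.circleInner_conjReflect_X_pow hp.natDegree_eq.le n.zero_le,
    Nat.sub_zero, hp.circleInner_X_pow_self, conj_circleInner]

variable [IsNontrivialMeasure μ]

theorem circleInner_self_ne_zero (hp : IsOrthogonalMonic μ n p) : circleInner μ p p ≠ 0 :=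
  JacobiOPUC.circleInner_self_ne_zero hp.monic.ne_zero

theorem eq_coeff_smul (hp : IsOrthogonalMonic μ n p) (hq : q.natDegree ≤ n)
    (horth : ∀ j < n, circleInner μ q (X ^ j) = 0) : q = q.coeff n • p := by
  refine sub_eq_zero.mp (eq_zero_of_circleInner_X_pow (μ := μ) fun j hj => ?_)
  rcases lt_trichotomy j n with hjn | rfl | hnj
  · simp [horth j hjn, hp.circleInner_X_pow j hjn]
  · simp [hp.coeff_self] at hj
  · simp [coeff_eq_zero_of_natDegree_lt (hq.trans_lt hnj),
      coeff_eq_zero_of_natDegree_lt (hp.natDegree_eq.trans_lt hnj)] at hj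

theorem eq (hp : IsOrthogonalMonic μ n p) (hq : IsOrthogonalMonic μ n q) : q = p := by
  simpa [hq.coeff_self] using hp.eq_coeff_smul hq.natDegree_eq.le hq.circleInner_X_pow

theorem eq_coeff_zero_smul_conjReflect (hp : IsOrthogonalMonic μ n p) (hq : q.natDegree ≤ n)
    (horth : ∀ j, 1 ≤ j → j ≤ n → circleInner μ q (X ^ j) = 0) :
    q = q.coeff 0 • conjReflect n p := by
  refine sub_eq_zero.mp (eq_zero_of_circleInner_X_pow (μ := μ) fun j hj => ?_)
  rcases Nat.eq_zero_or_pos j with rfl | hj1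
  · simp [hp.coeff_zero_conjReflect] at hj
  rcases le_or_gt j n with hjn | hnj
  · simp [horth j hj1 hjn, hp.circleInner_conjReflect_X_pow hj1 hjn]
  · simp [coeff_eq_zero_of_natDegree_lt (hq.trans_lt hnj),
      coeff_eq_zero_of_natDegree_lt (hp.natDegree_conjReflect_le.trans_lt hnj)] at hj

theorem succ (hp : IsOrthogonalMonic μ n p) :
    IsOrthogonalMonic μ (n + 1)
      (X * p - (circleInner μ (X * p) 1 / circleInner μ p p) • conjReflect n p) := by
  set c := circleInner μ (X * p) 1 / circleInner μ p p
  have hmonic : (X * p).Monic := monic_X.mul hp.monic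
  have hdeg : (X * p).natDegree = n + 1 := by
    rw [natDegree_X_mul hp.monic.ne_zero, hp.natDegree_eq]
  have hlt : (c • conjReflect n p).natDegree < (X * p).natDegree := by
    rw [hdeg, Nat.lt_succ_iff]
    exact (natDegree_smul_le _ _).trans hp.natDegree_conjReflect_le
  refine ⟨hmonic.sub_of_left (degree_lt_degree hlt), ?_, fun j hj => ?_⟩
  · rw [natDegree_sub_eq_left_of_natDegree_lt hlt, hdeg]
  rw [LinearMap.map_sub₂, LinearMap.map_smul₂, smul_eq_mul]
  rcases j with _ | j
  · rw [pow_zero, hp.circleInner_conjReflect_one, div_mul_cancel₀ _ hp.circleInner_self_ne_zero,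
      sub_self]
  · rw [circleInner_X_mul_X_pow_succ, hp.circleInner_X_pow j (by omega),
      hp.circleInner_conjReflect_X_pow j.succ_pos (by omega), mul_zero, sub_zero]

end IsOrthogonalMonic

theorem exists_isOrthogonalMonic (μ : Measure Circle) [IsFiniteMeasure μ]
    [IsNontrivialMeasure μ] (n : ℕ) : ∃ p, IsOrthogonalMonic μ n p := by
  induction n with
  | zero => exact ⟨1, monic_one, natDegree_one, by simp⟩
  | succ n ih => exact ih.imp' _ fun _ hp => hp.succ

end Orthogonality

section Szego

theorem coeff_zero_succ (Φ : ℕ → ℂ[X]) (m : ℕ) :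
    (Φ (m + 1)).coeff 0 = -conj (alpha Φ m) := by
  rw [alpha, map_neg, conj_conj, neg_neg, coeff_zero_eq_eval_zero]
  rfl

theorem coeff_zero_eq_neg_conj_alpha (Φ : ℕ → ℂ[X]) (m : ℕ) :
    (Φ m).coeff 0 = -conj (alpha Φ ((m : ℤ) - 1)) := by
  rw [alpha, map_neg, conj_conj, neg_neg, coeff_zero_eq_eval_zero, sub_add_cancel,
    Int.toNat_natCast]

theorem coeff_recip_self (Φ : ℕ → ℂ[X]) (m : ℕ) :
    (recip Φ m).coeff m = conj ((Φ m).coeff 0) := by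
  rw [recip, ← conjReflect, coeff_conjReflect _ le_rfl, Nat.sub_self]

variable {μ : Measure Circle} [IsFiniteMeasure μ] {Φ : ℕ → ℂ[X]}

theorem circleInner_recip_X_pow {m j : ℕ} (hΦ : IsOrthogonalMonic μ m (Φ m)) (hj : 1 ≤ j)
    (hjm : j ≤ m) : circleInner μ (recip Φ m) (X ^ j) = 0 :=
  hΦ.circleInner_conjReflect_X_pow hj hjm

variable [IsNontrivialMeasure μ]

theorem szego_recurrence (hΦ : ∀ n, IsOrthogonalMonic μ n (Φ n)) (m : ℕ) :
    X * Φ m = Φ (m + 1) + conj (alpha Φ m) • recip Φ m := by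
  have hsucc := (hΦ (m + 1)).eq (hΦ m).succ
  have hcoeff := congrArg (coeff · 0) hsucc
  simp only [coeff_sub, coeff_smul, mul_coeff_zero, coeff_X_zero, zero_mul,
    (hΦ m).coeff_zero_conjReflect, coeff_zero_succ, smul_eq_mul, mul_one, zero_sub,
    neg_inj] at hcoeff
  rw [hcoeff] at hsucc
  exact sub_eq_iff_eq_add.mp hsucc

theorem circleInner_self_succ (hΦ : ∀ n, IsOrthogonalMonic μ n (Φ n)) (m : ℕ) :
    circleInner μ (Φ (m + 1)) (Φ (m + 1)) =
      (1 - (‖alpha Φ m‖ : ℂ) ^ 2) * circleInner μ (Φ m) (Φ m) := by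
  have horth : circleInner μ (Φ (m + 1)) (recip Φ m) = 0 :=
    (hΦ (m + 1)).circleInner_eq_zero ((hΦ m).natDegree_conjReflect_le.trans_lt m.lt_succ_self)
  have horth' : circleInner μ (recip Φ m) (Φ (m + 1)) = 0 := by
    rw [← conj_circleInner, horth, map_zero]
  have hrecip : circleInner μ (recip Φ m) (recip Φ m) = circleInner μ (Φ m) (Φ m) :=
    circleInner_conjReflect_conjReflect (hΦ m).natDegree_eq.le (hΦ m).natDegree_eq.le
  have hpyth := circleInner_X_mul_X_mul μ (Φ m) (Φ m)
  simp only [szego_recurrence hΦ, map_add, map_smul, LinearMap.map_smulₛₗ,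
    LinearMap.add_apply, LinearMap.smul_apply, horth, horth', hrecip, smul_eq_mul,
    conj_conj] at hpyth
  linear_combination hpyth - circleInner μ (Φ m) (Φ m) * mul_conj' (alpha Φ m)

theorem one_sub_norm_alpha_sq_ne_zero (hΦ : ∀ n, IsOrthogonalMonic μ n (Φ n)) (m : ℕ) :
    1 - (‖alpha Φ m‖ : ℂ) ^ 2 ≠ 0 :=
  left_ne_zero_of_mul (circleInner_self_succ hΦ m ▸ (hΦ (m + 1)).circleInner_self_ne_zero)

theorem eq_smul_add_smul_recip (hΦ : ∀ n, IsOrthogonalMonic μ n (Φ n)) {m : ℕ} {q : ℂ[X]}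
    (hq : q.natDegree ≤ m + 1) (horth : ∀ j, 1 ≤ j → j ≤ m → circleInner μ q (X ^ j) = 0) :
    q = q.coeff (m + 1) • Φ (m + 1) +
      (q.coeff 0 + q.coeff (m + 1) * conj (alpha Φ m)) • recip Φ m := by
  set r := q - q.coeff (m + 1) • Φ (m + 1) with hr
  have hr_deg : r.natDegree ≤ m := natDegree_le_iff_coeff_eq_zero.mpr fun j hj => by
    rcases (Nat.succ_le_of_lt hj).eq_or_lt with rfl | hmj
    · simp [hr, (hΦ (m + 1)).coeff_self]
    · simp [hr, coeff_eq_zero_of_natDegree_lt (hq.trans_lt hmj),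
        coeff_eq_zero_of_natDegree_lt ((hΦ (m + 1)).natDegree_eq.trans_lt hmj)]
  have hr_orth : ∀ j, 1 ≤ j → j ≤ m → circleInner μ r (X ^ j) = 0 := fun j hj hjm => by
    simp [hr, horth j hj hjm, (hΦ (m + 1)).circleInner_X_pow j (by omega)]
  have hr_coeff : r.coeff 0 = q.coeff 0 + q.coeff (m + 1) * conj (alpha Φ m) := by
    simp [hr, coeff_zero_succ]
  rw [← hr_coeff]
  exact sub_eq_iff_eq_add'.mp ((hΦ m).eq_coeff_zero_smul_conjReflect hr_deg hr_orth)

end Szego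

section CauchyTransform

variable {μ : Measure Circle} {z : ℂ}

theorem coe_circle_sub_ne_zero (hz : ‖z‖ ≠ 1) (t : Circle) : (t : ℂ) - z ≠ 0 :=
  sub_ne_zero.mpr fun h => hz (h ▸ t.norm_coe)

theorem hasDerivAt_integral_div_sub {f : Circle → ℂ} (hf : Integrable f μ) (hz : ‖z‖ ≠ 1) :
    HasDerivAt (fun w => ∫ t, f t / (t - w) ∂μ) (∫ t, f t / (t - z) ^ 2 ∂μ) z := by
  set δ : ℝ := |1 - ‖z‖| / 2 with hδ
  have hδ0 : 0 < δ := half_pos (abs_pos.mpr (sub_ne_zero.mpr hz.symm))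
  have hdist : ∀ w ∈ Metric.ball z δ, ∀ t : Circle, δ ≤ ‖(t : ℂ) - w‖ := by
    intro w hw t
    have hwz : ‖w - z‖ < δ := by simpa [dist_eq_norm] using hw
    have htz : |1 - ‖z‖| ≤ ‖(t : ℂ) - z‖ := t.norm_coe ▸ abs_norm_sub_norm_le (t : ℂ) z
    have htri : ‖(t : ℂ) - z‖ ≤ ‖(t : ℂ) - w‖ + ‖w - z‖ := norm_sub_le_norm_sub_add_norm_sub ..
    linarith
  have hmeas (w : ℂ) (k : ℕ) : AEStronglyMeasurable (fun t : Circle => f t / (t - w) ^ k) μ :=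
    hf.1.aemeasurable.div (Measurable.aemeasurable (by fun_prop)) |>.aestronglyMeasurable
  have hbound (k : ℕ) {w : ℂ} (hw : w ∈ Metric.ball z δ) (t : Circle) :
      ‖f t / (t - w) ^ k‖ ≤ ‖f t‖ / δ ^ k := by
    rw [norm_div, norm_pow]
    gcongr
    exact hdist w hw t
  have hz_mem : z ∈ Metric.ball z δ := Metric.mem_ball_self hδ0
  refine (hasDerivAt_integral_of_dominated_loc_of_deriv_le (Metric.ball_mem_nhds z hδ0)
    (.of_forall fun w => by simpa using hmeas w 1) ?_ (hmeas z 2)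
    (.of_forall fun t w hw => hbound 2 hw t) (hf.norm.div_const _)
    (.of_forall fun t w hw => ?_)).2
  · exact (hf.norm.div_const (δ ^ 1)).mono' (by simpa using hmeas z 1)
      (.of_forall fun t => by simpa using hbound 1 hz_mem t)
  · have htw : (t : ℂ) - w ≠ 0 := norm_pos_iff.mp (hδ0.trans_le (hdist w hw t))
    simpa [div_eq_mul_inv] using
      (((hasDerivAt_id w).const_sub (t : ℂ)).fun_inv htw).const_mul (f t)

/-- The Cauchy transform `∫ p(t) t⁻ᵐ / (t - z) dμ(t)`; the functions `G` and `Gstar` are its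
multiples by `1 / 2π`. -/
def cauchyTransform (μ : Measure Circle) (m : ℕ) (p : ℂ[X]) (z : ℂ) : ℂ :=
  ∫ t : Circle, p.eval (t : ℂ) * ((t : ℂ) ^ m)⁻¹ / (t - z) ∂μ

theorem cauchyTransform_C_mul (m : ℕ) (c : ℂ) (p : ℂ[X]) :
    cauchyTransform μ m (C c * p) z = c * cauchyTransform μ m p z := by
  simp only [cauchyTransform, eval_mul, eval_C, mul_assoc, mul_div_assoc, integral_const_mul]

theorem continuous_eval_mul_inv_pow (p : ℂ[X]) (m : ℕ) :
    Continuous fun t : Circle => p.eval (t : ℂ) * ((t : ℂ) ^ m)⁻¹ :=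
  Continuous.mul (by fun_prop) (.inv₀ (by fun_prop) fun t => pow_ne_zero m t.coe_ne_zero)

theorem continuous_div_coe_circle_sub_pow {f : Circle → ℂ} (hf : Continuous f) (hz : ‖z‖ ≠ 1)
    (k : ℕ) : Continuous fun t : Circle => f t / (t - z) ^ k :=
  hf.div (by fun_prop) fun t => pow_ne_zero k (coe_circle_sub_ne_zero hz t)

variable [IsFiniteMeasure μ] (m : ℕ) (p q : ℂ[X])

theorem integrable_eval_mul_inv_pow :
    Integrable (fun t : Circle => p.eval (t : ℂ) * ((t : ℂ) ^ m)⁻¹) μ :=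
  integrable_of_continuous μ (continuous_eval_mul_inv_pow p m)

theorem integrable_cauchyTransform_integrand (hz : ‖z‖ ≠ 1) :
    Integrable (fun t : Circle => p.eval (t : ℂ) * ((t : ℂ) ^ m)⁻¹ / (t - z)) μ :=
  integrable_of_continuous μ (by
    simpa using continuous_div_coe_circle_sub_pow (continuous_eval_mul_inv_pow p m) hz 1)

theorem hasDerivAt_cauchyTransform (hz : ‖z‖ ≠ 1) :
    HasDerivAt (cauchyTransform μ m p)
      (∫ t : Circle, p.eval (t : ℂ) * ((t : ℂ) ^ m)⁻¹ / (t - z) ^ 2 ∂μ) z :=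
  hasDerivAt_integral_div_sub (integrable_eval_mul_inv_pow m p) hz

theorem cauchyTransform_add (hz : ‖z‖ ≠ 1) :
    cauchyTransform μ m (p + q) z = cauchyTransform μ m p z + cauchyTransform μ m q z := by
  simp only [cauchyTransform, eval_add, add_mul, add_div]
  exact integral_add (integrable_cauchyTransform_integrand m p hz)
    (integrable_cauchyTransform_integrand m q hz)

theorem cauchyTransform_X_mul (hz : ‖z‖ ≠ 1) :
    cauchyTransform μ m (X * p) z =
      z * cauchyTransform μ m p z + circleInner μ p (X ^ m) := by
  rw [circleInner_X_pow, cauchyTransform, cauchyTransform, ← integral_const_mul,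
    ← integral_add ((integrable_cauchyTransform_integrand m p hz).const_mul z)
      (integrable_eval_mul_inv_pow m p)]
  refine integral_congr_ae (.of_forall fun t => ?_)
  have ht := coe_circle_sub_ne_zero hz t
  simp only [eval_mul, eval_X]
  field_simp
  ring

variable {m p q}

theorem cauchyTransform_mul (hz : ‖z‖ ≠ 1) (hq : q.natDegree ≤ m + 1) :
    cauchyTransform μ m (p * q) z =
      q.eval z * cauchyTransform μ m p z +
        circleInner μ p (conjReflect m (q /ₘ (X - C z))) := by
  have hdeg : (q /ₘ (X - C z)).natDegree ≤ m := by
    rw [natDegree_divByMonic q (monic_X_sub_C z), natDegree_X_sub_C]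
    omega
  have hdiv : p * q = C (q.eval z) * p +
      (X * (p * (q /ₘ (X - C z))) + C (-z) * (p * (q /ₘ (X - C z)))) := by
    conv_lhs => rw [← modByMonic_add_div q (X - C z), modByMonic_X_sub_C_eq_C_eval]
    rw [C_neg]
    ring
  rw [hdiv, cauchyTransform_add _ _ _ hz, cauchyTransform_add _ _ _ hz,
    cauchyTransform_X_mul _ _ hz, cauchyTransform_C_mul, cauchyTransform_C_mul,
    circleInner_mul_X_pow p hdeg]
  ring

theorem wronskian_cauchyTransform {Φ : ℕ → ℂ[X]} (hΦ : ∀ n, IsOrthogonalMonic μ n (Φ n))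
    (m : ℕ) (hz : ‖z‖ ≠ 1) :
    (Φ (m + 1)).eval z * cauchyTransform μ m (recip Φ m) z -
        (recip Φ m).eval z * cauchyTransform μ m (Φ (m + 1)) z =
      -circleInner μ (Φ m) (Φ m) := by
  have hp := hΦ (m + 1)
  have hrecip_deg : (recip Φ m).natDegree ≤ m := (hΦ m).natDegree_conjReflect_le
  set S := Φ (m + 1) /ₘ (X - C z) with hS
  have hS_deg : S.natDegree = m := by
    rw [natDegree_divByMonic _ (monic_X_sub_C z), natDegree_X_sub_C, hp.natDegree_eq,
      Nat.add_sub_cancel]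
  have hS_coeff : S.coeff m = 1 := by
    conv_lhs => rw [← hS_deg, coeff_natDegree]
    rw [leadingCoeff_divByMonic_X_sub_C _ _ z, hp.monic]
    rw [degree_eq_natDegree hp.monic.ne_zero, hp.natDegree_eq]
    exact_mod_cast m.succ_ne_zero
  have hpS : circleInner μ (recip Φ m) (conjReflect m S) = circleInner μ (Φ m) (Φ m) := by
    change circleInner μ (conjReflect m (Φ m)) _ = _
    rw [circleInner_conjReflect_conjReflect (hΦ m).natDegree_eq.le hS_deg.le, ← conj_circleInner,
      (hΦ m).circleInner_of_natDegree_le hS_deg.le, hS_coeff, map_one, one_mul,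
      (hΦ m).circleInner_X_pow_self, conj_circleInner]
  have horth : circleInner μ (Φ (m + 1)) (conjReflect m (recip Φ m /ₘ (X - C z))) = 0 := by
    refine hp.circleInner_eq_zero (Nat.lt_succ_of_le (natDegree_conjReflect_le ?_))
    rw [natDegree_divByMonic _ (monic_X_sub_C z), natDegree_X_sub_C]
    omega
  have hleft := cauchyTransform_mul (μ := μ) (p := recip Φ m) hz hp.natDegree_eq.le
  have hright := cauchyTransform_mul (μ := μ) (p := Φ (m + 1)) hz (hrecip_deg.trans m.le_succ)
  rw [mul_comm, hright, horth, ← hS, hpS] at hleft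
  linear_combination -hleft

end CauchyTransform

section Pearson

variable {b : ℂ} {μ : Measure Circle}

/-- The weak form of the Pearson differential equation of the Jacobi weight: integration by parts
against `μ` turns `(1 - t) t g'(t)` into `((b + 1) t + conj b) g(t)`. -/
def PearsonEquation (b : ℂ) (μ : Measure Circle) : Prop :=
  ∀ (g : ℂ → ℂ) (g' : Circle → ℂ), (∀ t : Circle, HasDerivAt g (g' t) t) → Continuous g' →
    ∫ t : Circle, ((1 - t) * t * g' t - ((b + 1) * t + conj b) * g t) ∂μ = 0

theorem coeff_X_mul_derivative (p : ℂ[X]) (j : ℕ) :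
    (X * derivative p).coeff j = j * p.coeff j := by
  rcases j with _ | j
  · simp
  · rw [coeff_X_mul, coeff_derivative, mul_comm, Nat.cast_succ]

theorem coeff_X_sub_one_mul_derivative (p : ℂ[X]) (j : ℕ) :
    ((X - 1) * derivative p).coeff j = j * p.coeff j - p.coeff (j + 1) * (j + 1) := by
  rw [sub_mul, one_mul, coeff_sub, coeff_X_mul_derivative, coeff_derivative]

theorem coeff_one_sub_X_mul_X_mul_derivative_sub (c : ℂ) (p : ℂ[X]) (j : ℕ) :
    ((1 - X) * X * derivative p - C c * (X * p)).coeff (j + 1) =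
      (j + 1) * p.coeff (j + 1) - (c + j) * p.coeff j := by
  have hexpand : (1 - X) * X * derivative p - C c * (X * p) =
      X * derivative p - X * (X * derivative p) - C c * (X * p) := by
    ring
  simp only [hexpand, coeff_sub, coeff_C_mul, coeff_X_mul, coeff_X_mul_derivative,
    coeff_derivative]
  ring

theorem natDegree_X_sub_one_mul_derivative_sub_le {p : ℂ[X]} {n : ℕ} (hp : p.natDegree ≤ n + 1) :
    ((X - 1) * derivative p - (n + 1 : ℂ) • p).natDegree ≤ n :=
  natDegree_le_iff_coeff_eq_zero.mpr fun j hj => by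
    have hsucc : p.coeff (j + 1) = 0 := coeff_eq_zero_of_natDegree_lt (by omega)
    rw [coeff_sub, coeff_X_sub_one_mul_derivative, coeff_smul, hsucc, smul_eq_mul]
    rcases (Nat.succ_le_of_lt hj).eq_or_lt with rfl | hj
    · push_cast
      ring
    · rw [coeff_eq_zero_of_natDegree_lt (hp.trans_lt hj)]
      ring

theorem hasDerivAt_eval_mul_inv_pow (p : ℂ[X]) (m : ℕ) {t : ℂ} (ht : t ≠ 0) :
    HasDerivAt (fun w => p.eval w * (w ^ m)⁻¹)
      ((X * derivative p - C (m : ℂ) * p).eval t * (t ^ (m + 1))⁻¹) t := by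
  refine ((p.hasDerivAt t).fun_mul ((hasDerivAt_pow m t).fun_inv (pow_ne_zero m ht))).congr_deriv ?_
  simp only [eval_sub, eval_mul, eval_X, eval_C]
  rcases m with _ | m
  · simp [mul_comm t, ht]
  · rw [Nat.add_sub_cancel]
    field_simp
    ring

variable [IsFiniteMeasure μ]

theorem PearsonEquation.circleInner_X_sub_one_mul_derivative (hμ : PearsonEquation b μ)
    (p : ℂ[X]) (j : ℕ) :
    circleInner μ ((X - 1) * derivative p) (X ^ j) =
      -((b - j) * circleInner μ p (X ^ j) +
        (conj b + (j + 1)) * circleInner μ p (X ^ (j + 1))) := by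
  have hparts := hμ _ _ (fun t => hasDerivAt_eval_mul_inv_pow p (j + 1) t.coe_ne_zero)
    (continuous_eval_mul_inv_pow _ _)
  have hpoly : circleInner μ (X * ((X - 1) * derivative p) + (b - j) • (X * p) +
      (conj b + (j + 1)) • p) (X ^ (j + 1)) = 0 := by
    rw [circleInner_X_pow, ← neg_eq_zero, ← integral_neg, ← hparts]
    refine integral_congr_ae (.of_forall fun t => ?_)
    have ht : (t : ℂ) ≠ 0 := t.coe_ne_zero
    simp only [eval_add, eval_sub, eval_mul, eval_smul, eval_X, eval_C, eval_one, smul_eq_mul]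
    push_cast
    field_simp
    ring
  simp only [map_add, map_smul, LinearMap.add_apply, LinearMap.smul_apply, smul_eq_mul,
    circleInner_X_mul_X_pow_succ] at hpoly
  linear_combination hpoly

theorem PearsonEquation.circleInner_one_sub_X_mul_X_mul_derivative_sub (hμ : PearsonEquation b μ)
    (p : ℂ[X]) (j : ℕ) :
    circleInner μ ((1 - X) * X * derivative p - C b * (X * p)) (X ^ (j + 1)) =
      (conj b + (j + 1)) * circleInner μ p (X ^ (j + 1)) - j * circleInner μ p (X ^ j) := by
  have hfactor : (1 - X) * X * derivative p - C b * (X * p) =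
      -(X * ((X - 1) * derivative p)) - b • (X * p) := by
    rw [smul_eq_C_mul]
    ring
  rw [hfactor, map_sub, map_neg, map_smul, LinearMap.sub_apply, LinearMap.neg_apply,
    LinearMap.smul_apply, circleInner_X_mul_X_pow_succ, circleInner_X_mul_X_pow_succ,
    hμ.circleInner_X_sub_one_mul_derivative, smul_eq_mul]
  ring

theorem PearsonEquation.mul_deriv_cauchyTransform (hμ : PearsonEquation b μ) (m : ℕ) (p : ℂ[X])
    {z : ℂ} (hz : ‖z‖ ≠ 1) :
    z * (1 - z) * deriv (cauchyTransform μ m p) z =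
      cauchyTransform μ m ((1 - X) * X * derivative p) z +
        ((m + 1 - b) * z - (conj b + (m + 1))) * cauchyTransform μ m p z +
        (m - b) * circleInner μ p (X ^ m) := by
  set B := (1 - X) * X * derivative p + (C (m - b - 1) * (X * p) +
    C (2 * z - conj b - (m + 1)) * p) with hB
  have hderiv (t : Circle) := (hasDerivAt_eval_mul_inv_pow p m t.coe_ne_zero).fun_div
    ((hasDerivAt_id (t : ℂ)).sub_const z) (coe_circle_sub_ne_zero hz t)
  have hparts := hμ _ _ hderiv (continuous_div_coe_circle_sub_pow
    (((continuous_eval_mul_inv_pow _ _).mul (by fun_prop)).sub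
      ((continuous_eval_mul_inv_pow _ _).mul_const 1)) hz 2)
  have hint := integrable_eval_mul_inv_pow (μ := μ) m p
  have hintB := integrable_cauchyTransform_integrand (μ := μ) m B hz
  have hint2 := integrable_of_continuous μ
    (continuous_div_coe_circle_sub_pow (continuous_eval_mul_inv_pow p m) hz 2)
  have hdecomp : circleInner μ p (X ^ m) + cauchyTransform μ m B z -
      z * (1 - z) * deriv (cauchyTransform μ m p) z = 0 := by
    rw [(hasDerivAt_cauchyTransform m p hz).deriv, circleInner_X_pow, cauchyTransform,
      ← integral_const_mul, ← integral_add hint hintB, ← integral_sub (hint.fun_add hintB)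
      (hint2.const_mul _), ← hparts]
    refine integral_congr_ae (.of_forall fun t => ?_)
    have ht : (t : ℂ) ≠ 0 := t.coe_ne_zero
    have htz := coe_circle_sub_ne_zero hz t
    -- Partial fractions: `(1 - t) t / (t - z)² = z (1 - z) / (t - z)² + (1 - 2 z) / (t - z) - 1`.
    simp only [hB, eval_add, eval_sub, eval_mul, eval_X, eval_C, eval_one, id]
    field_simp
    ring
  rw [hB, cauchyTransform_add _ _ _ hz, cauchyTransform_add _ _ _ hz, cauchyTransform_C_mul,
    cauchyTransform_C_mul, cauchyTransform_X_mul _ _ hz] at hdecomp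
  linear_combination -hdecomp

variable [IsNontrivialMeasure μ] {Φ : ℕ → ℂ[X]}

theorem PearsonEquation.X_sub_one_mul_derivative (hμ : PearsonEquation b μ)
    (hΦ : ∀ n, IsOrthogonalMonic μ n (Φ n)) (m : ℕ) :
    (X - 1) * derivative (Φ (m + 1)) =
      -((conj b + (m + 1)) * (1 - (‖alpha Φ m‖ : ℂ) ^ 2)) • Φ m + (m + 1 : ℂ) • Φ (m + 1) := by
  set q := (X - 1) * derivative (Φ (m + 1)) - (m + 1 : ℂ) • Φ (m + 1) with hq
  have hpair {j : ℕ} (hj : j < m + 1) : circleInner μ q (X ^ j) =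
      -((conj b + (j + 1)) * circleInner μ (Φ (m + 1)) (X ^ (j + 1))) := by
    rw [hq, map_sub, map_smul, LinearMap.sub_apply, LinearMap.smul_apply,
      hμ.circleInner_X_sub_one_mul_derivative, (hΦ (m + 1)).circleInner_X_pow j hj]
    simp
  have hq_smul : q = q.coeff m • Φ m :=
    (hΦ m).eq_coeff_smul (natDegree_X_sub_one_mul_derivative_sub_le (hΦ (m + 1)).natDegree_eq.le)
      fun j hj => by
        rw [hpair (hj.trans m.lt_succ_self),
          (hΦ (m + 1)).circleInner_X_pow _ (Nat.succ_lt_succ hj), mul_zero, neg_zero]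
  have hcoeff : q.coeff m = -((conj b + (m + 1)) * (1 - (‖alpha Φ m‖ : ℂ) ^ 2)) := by
    have hnorm := hpair m.lt_succ_self
    rw [hq_smul, map_smul, LinearMap.smul_apply, (hΦ m).circleInner_X_pow_self,
      (hΦ (m + 1)).circleInner_X_pow_self, circleInner_self_succ hΦ, smul_eq_mul] at hnorm
    exact mul_right_cancel₀ (hΦ m).circleInner_self_ne_zero (by linear_combination hnorm)
  rw [← hcoeff, ← hq_smul, hq, sub_add_cancel]

theorem PearsonEquation.coeff_succ_self (hμ : PearsonEquation b μ)
    (hΦ : ∀ n, IsOrthogonalMonic μ n (Φ n)) (m : ℕ) :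
    (Φ (m + 1)).coeff m = conj b - (conj b + (m + 1)) * (‖alpha Φ m‖ : ℂ) ^ 2 := by
  have hcoeff := congrArg (coeff · m) (hμ.X_sub_one_mul_derivative hΦ m)
  simp only [coeff_X_sub_one_mul_derivative, coeff_add, coeff_smul, smul_eq_mul,
    (hΦ m).coeff_self, (hΦ (m + 1)).coeff_self] at hcoeff
  linear_combination -hcoeff

theorem PearsonEquation.verblunsky_recurrence (hμ : PearsonEquation b μ)
    (hΦ : ∀ n, IsOrthogonalMonic μ n (Φ n)) (m : ℕ) :
    (conj b + (m + 1)) * alpha Φ m = (b + m) * alpha Φ ((m : ℤ) - 1) := by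
  have hrecip_one : (recip Φ m).coeff 1 = conj ((X * Φ m).coeff m) := by
    rw [recip, ← conjReflect, ← conjReflect_X_mul (hΦ m).natDegree_eq.le,
      coeff_conjReflect _ (by omega), Nat.add_sub_cancel]
  have hX_one : (X * Φ m).coeff 1 = (Φ m).coeff 0 := coeff_X_mul _ 0
  have hsub := congrArg (coeff · m) (szego_recurrence hΦ m)
  have hone := congrArg (coeff · 1) (szego_recurrence hΦ m)
  have hzero := congrArg (coeff · 0) (hμ.X_sub_one_mul_derivative hΦ m)
  simp only [coeff_add, coeff_smul, smul_eq_mul, coeff_recip_self, hμ.coeff_succ_self hΦ,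
    coeff_zero_eq_neg_conj_alpha Φ m] at hsub
  simp only [coeff_add, coeff_smul, smul_eq_mul, hrecip_one, hsub, hX_one,
    coeff_zero_eq_neg_conj_alpha Φ m, map_add, map_sub, map_mul, map_neg, map_pow, map_one,
    map_natCast, conj_conj, conj_ofReal] at hone
  simp only [coeff_X_sub_one_mul_derivative, coeff_add, coeff_smul, smul_eq_mul,
    coeff_zero_succ, coeff_zero_eq_neg_conj_alpha Φ m, CharP.cast_eq_zero, zero_add, zero_mul,
    mul_one, zero_sub] at hzero
  have hconj : (b + (m + 1)) * conj (alpha Φ m) =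
      (conj b + m) * conj (alpha Φ ((m : ℤ) - 1)) := by
    refine mul_left_cancel₀ (one_sub_norm_alpha_sq_ne_zero hΦ m) ?_
    linear_combination hzero - hone +
      conj (alpha Φ ((m : ℤ) - 1)) * mul_conj' (alpha Φ m)
  simpa using congrArg conj hconj

theorem PearsonEquation.structure_relation (hμ : PearsonEquation b μ)
    (hΦ : ∀ n, IsOrthogonalMonic μ n (Φ n)) (m : ℕ) :
    (1 - X) * X * derivative (Φ (m + 1)) = C (-(m + 1 : ℂ)) * (X * Φ (m + 1)) +
      (C ((conj b + (m + 1)) * (1 - (‖alpha Φ m‖ : ℂ) ^ 2)) * Φ (m + 1) +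
        C ((conj b + (m + 1)) * (1 - (‖alpha Φ m‖ : ℂ) ^ 2) * conj (alpha Φ m)) * recip Φ m) := by
  have hlower := hμ.X_sub_one_mul_derivative hΦ m
  have hszego := szego_recurrence hΦ m
  simp only [smul_eq_C_mul, C_mul, C_neg] at hlower hszego ⊢
  linear_combination -X * hlower + C (conj b + (m + 1)) * C (1 - (‖alpha Φ m‖ : ℂ) ^ 2) * hszego

theorem PearsonEquation.structure_relation_recip (hμ : PearsonEquation b μ)
    (hΦ : ∀ n, IsOrthogonalMonic μ n (Φ n)) (m : ℕ) :
    (1 - X) * X * derivative (recip Φ m) = C b * (X * recip Φ m) +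
      (C ((conj b + (m + 1)) * (‖alpha Φ m‖ : ℂ) ^ 2) * recip Φ m +
        C ((conj b + (m + 1)) * alpha Φ m) * Φ (m + 1)) := by
  set q := (1 - X) * X * derivative (recip Φ m) - C b * (X * recip Φ m) with hq
  have hrecip_deg : (recip Φ m).natDegree ≤ m := (hΦ m).natDegree_conjReflect_le
  have hcoeff_zero : q.coeff 0 = 0 := by simp [hq]
  have hcoeff_succ : q.coeff (m + 1) = (conj b + (m + 1)) * alpha Φ m := by
    rw [hq, coeff_one_sub_X_mul_X_mul_derivative_sub, coeff_recip_self,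
      coeff_eq_zero_of_natDegree_lt (Nat.lt_succ_of_le hrecip_deg),
      coeff_zero_eq_neg_conj_alpha, map_neg, conj_conj, hμ.verblunsky_recurrence hΦ]
    ring
  have hdeg : q.natDegree ≤ m + 1 := natDegree_le_iff_coeff_eq_zero.mpr fun j hj => by
    obtain ⟨i, rfl⟩ := Nat.exists_eq_add_one.mpr (Nat.zero_lt_of_lt hj)
    rw [hq, coeff_one_sub_X_mul_X_mul_derivative_sub,
      coeff_eq_zero_of_natDegree_lt (n := i) (by omega),
      coeff_eq_zero_of_natDegree_lt (n := i + 1) (by omega), mul_zero, mul_zero, sub_zero]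
  have horth : ∀ j, 1 ≤ j → j ≤ m → circleInner μ q (X ^ j) = 0 := fun j hj hjm => by
    obtain ⟨i, rfl⟩ := Nat.exists_eq_add_one.mpr hj
    rw [hq, hμ.circleInner_one_sub_X_mul_X_mul_derivative_sub,
      circleInner_recip_X_pow (hΦ m) hj hjm, mul_zero, zero_sub, neg_eq_zero]
    rcases i.eq_zero_or_pos with rfl | hi
    · simp
    · exact mul_eq_zero_of_right _ (circleInner_recip_X_pow (hΦ m) hi (by omega))
  have hsum := eq_smul_add_smul_recip hΦ hdeg horth
  rw [hcoeff_zero, zero_add, hcoeff_succ, mul_assoc, mul_conj', hq] at hsum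
  simp only [smul_eq_C_mul] at hsum
  linear_combination hsum

theorem PearsonEquation.mul_deriv_cauchyTransform_succ (hμ : PearsonEquation b μ)
    (hΦ : ∀ n, IsOrthogonalMonic μ n (Φ n)) (m : ℕ) {z : ℂ} (hz : ‖z‖ ≠ 1) :
    z * (1 - z) * deriv (cauchyTransform μ m (Φ (m + 1))) z =
      (-b * z - (conj b + (m + 1)) * (‖alpha Φ m‖ : ℂ) ^ 2) *
          cauchyTransform μ m (Φ (m + 1)) z +
        (conj b + (m + 1)) * (1 - (‖alpha Φ m‖ : ℂ) ^ 2) * conj (alpha Φ m) *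
          cauchyTransform μ m (recip Φ m) z := by
  rw [hμ.mul_deriv_cauchyTransform m _ hz, hμ.structure_relation hΦ, cauchyTransform_add _ _ _ hz,
    cauchyTransform_add _ _ _ hz, cauchyTransform_C_mul, cauchyTransform_C_mul,
    cauchyTransform_C_mul, cauchyTransform_X_mul _ _ hz,
    (hΦ (m + 1)).circleInner_X_pow m m.lt_succ_self]
  ring

theorem PearsonEquation.mul_deriv_cauchyTransform_recip (hμ : PearsonEquation b μ)
    (hΦ : ∀ n, IsOrthogonalMonic μ n (Φ n)) (m : ℕ) {z : ℂ} (hz : ‖z‖ ≠ 1) :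
    z * (1 - z) * deriv (cauchyTransform μ m (recip Φ m)) z =
      ((m + 1) * z - (conj b + (m + 1)) * (1 - (‖alpha Φ m‖ : ℂ) ^ 2)) *
          cauchyTransform μ m (recip Φ m) z +
        (conj b + (m + 1)) * alpha Φ m * cauchyTransform μ m (Φ (m + 1)) z := by
  have hlast : (m : ℂ) * circleInner μ (recip Φ m) (X ^ m) = 0 := by
    rcases m.eq_zero_or_pos with rfl | hm
    · simp
    · exact mul_eq_zero_of_right _ (circleInner_recip_X_pow (hΦ m) hm le_rfl)
  rw [hμ.mul_deriv_cauchyTransform m _ hz, hμ.structure_relation_recip hΦ,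
    cauchyTransform_add _ _ _ hz, cauchyTransform_add _ _ _ hz, cauchyTransform_C_mul,
    cauchyTransform_C_mul, cauchyTransform_C_mul, cauchyTransform_X_mul _ _ hz]
  linear_combination hlast

end Pearson

section JacobiMeasure

variable {b : ℂ} {θ : ℝ}

theorem exp_mul_I_eq_sq (θ : ℝ) : exp (θ * I) = exp (θ / 2 * I) ^ 2 := by
  rw [← exp_nat_mul]
  congr 1
  push_cast
  ring

theorem exp_half_mul_two_sin_half (θ : ℝ) :
    exp (θ / 2 * I) * (2 * Real.sin (θ / 2) : ℝ) = I * (1 - exp (θ * I)) := by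
  push_cast
  rw [Complex.sin, exp_mul_I_eq_sq, neg_mul, exp_neg]
  field_simp

theorem exp_half_mul_cos_half (θ : ℝ) :
    exp (θ / 2 * I) * (Real.cos (θ / 2) : ℝ) = (1 + exp (θ * I)) / 2 := by
  push_cast
  rw [Complex.cos, exp_mul_I_eq_sq, neg_mul, exp_neg]
  field_simp
  ring

theorem two_sin_half_pos (hθ : θ ∈ Ioo 0 (2 * Real.pi)) : 0 < 2 * Real.sin (θ / 2) :=
  mul_pos two_pos (Real.sin_pos_of_pos_of_lt_pi (by linarith [hθ.1]) (by linarith [hθ.2]))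

theorem hasDerivAt_two_sin_half (θ : ℝ) :
    HasDerivAt (fun x : ℝ => 2 * Real.sin (x / 2)) (Real.cos (θ / 2)) θ := by
  refine (((hasDerivAt_id θ).div_const 2).sin.const_mul 2).congr_deriv ?_
  simp only [id]
  ring

theorem continuous_two_sin_half_rpow {s : ℝ} (hs : 0 ≤ s) :
    Continuous fun x : ℝ => (2 * Real.sin (x / 2)) ^ s :=
  Continuous.rpow_const (by fun_prop) fun _ => Or.inr hs

theorem hasDerivAt_two_sin_half_rpow (s : ℝ) (hθ : θ ∈ Ioo 0 (2 * Real.pi)) :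
    HasDerivAt (fun x : ℝ => (2 * Real.sin (x / 2)) ^ (s + 1))
      ((s + 1) * (2 * Real.sin (θ / 2)) ^ s * Real.cos (θ / 2)) θ := by
  refine ((hasDerivAt_two_sin_half θ).rpow_const (p := s + 1)
    (Or.inl (two_sin_half_pos hθ).ne')).congr_deriv ?_
  rw [add_sub_cancel_right]
  ring

theorem intervalIntegrable_two_sin_half_rpow {s : ℝ} (hs : -1 < s) :
    IntervalIntegrable (fun x : ℝ => (2 * Real.sin (x / 2)) ^ s) volume 0 (2 * Real.pi) := by
  have hcont := continuous_two_sin_half_rpow (show 0 ≤ s + 2 by linarith)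
  have hderiv : ∀ θ ∈ Ioo 0 (2 * Real.pi), HasDerivAt
      (fun x : ℝ => Real.cos (x / 2) * (2 * Real.sin (x / 2)) ^ (s + 1) +
        (s + 2) / 4 * ∫ y in (0 : ℝ)..x, (2 * Real.sin (y / 2)) ^ (s + 2))
      ((s + 1) * (2 * Real.sin (θ / 2)) ^ s) θ := by
    intro θ hθ
    have hcos : HasDerivAt (fun x : ℝ => Real.cos (x / 2)) (-Real.sin (θ / 2) * (1 / 2)) θ :=
      ((hasDerivAt_id θ).div_const 2).cos
    refine ((hcos.fun_mul (hasDerivAt_two_sin_half_rpow s hθ)).fun_add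
      ((hcont.integral_hasStrictDerivAt 0 θ).hasDerivAt.const_mul _)).congr_deriv ?_
    have hpow_one := Real.rpow_add_one (two_sin_half_pos hθ).ne' s
    have hpow_two := Real.rpow_add_one (two_sin_half_pos hθ).ne' (s + 1)
    rw [show s + 2 = s + 1 + 1 by ring, hpow_two, hpow_one]
    linear_combination (s + 1) * (2 * Real.sin (θ / 2)) ^ s * Real.sin_sq_add_cos_sq (θ / 2)
  have hint := intervalIntegral.intervalIntegrable_deriv_of_nonneg (a := 0) (b := 2 * Real.pi)
    (Continuous.continuousOn ?_) (by simpa [Real.two_pi_pos.le] using hderiv) ?_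
  · have hs' : s + 1 ≠ 0 := by linarith
    simpa [← mul_assoc, inv_mul_cancel₀ hs'] using hint.const_mul (s + 1)⁻¹
  · have := continuous_two_sin_half_rpow (show 0 ≤ s + 1 by linarith)
    have := intervalIntegral.continuous_primitive (fun _ _ => hcont.intervalIntegrable _ _) 0
      (μ := volume)
    fun_prop
  · intro θ hθ
    rw [min_eq_left Real.two_pi_pos.le, max_eq_right Real.two_pi_pos.le] at hθ
    have := Real.rpow_nonneg (two_sin_half_pos hθ).le s
    nlinarith

/-- The Jacobi weight in the angular coordinate: `ν(e^{iθ})` for `0 < θ < 2π`. -/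
def density (b : ℂ) (θ : ℝ) : ℝ :=
  Real.exp (b.im * (Real.pi - θ)) * (2 * Real.sin (θ / 2)) ^ (2 * b.re)

theorem density_pos (b : ℂ) (hθ : θ ∈ Ioo 0 (2 * Real.pi)) : 0 < density b θ :=
  mul_pos (Real.exp_pos _) (Real.rpow_pos_of_pos (two_sin_half_pos hθ) _)

theorem density_add_half (b : ℂ) (hθ : θ ∈ Ioo 0 (2 * Real.pi)) :
    density (b + 1 / 2) θ = density b θ * (2 * Real.sin (θ / 2)) := by
  have hre : 2 * (b + 1 / 2).re = 2 * b.re + 1 := by simp [mul_add]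
  have him : (b + 1 / 2).im = b.im := by simp
  rw [density, density, hre, him, Real.rpow_add_one (two_sin_half_pos hθ).ne', mul_assoc]

theorem hasDerivAt_density_add_half (b : ℂ) (hθ : θ ∈ Ioo 0 (2 * Real.pi)) :
    HasDerivAt (density (b + 1 / 2))
      (density b θ * ((2 * b.re + 1) * Real.cos (θ / 2) - b.im * (2 * Real.sin (θ / 2)))) θ := by
  have hre : 2 * (b + 1 / 2).re = 2 * b.re + 1 := by simp [mul_add]
  have him : (b + 1 / 2).im = b.im := by simp
  unfold density
  rw [hre, him]
  refine ((((hasDerivAt_id θ).const_sub Real.pi).const_mul b.im).exp.fun_mul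
    (hasDerivAt_two_sin_half_rpow (2 * b.re) hθ)).congr_deriv ?_
  rw [Real.rpow_add_one (two_sin_half_pos hθ).ne']
  simp only [id]
  ring

theorem continuous_density (hb : 0 ≤ b.re) : Continuous (density b) :=
  (by fun_prop : Continuous fun x : ℝ => Real.exp (b.im * (Real.pi - x))).mul
    (continuous_two_sin_half_rpow (mul_nonneg zero_le_two hb))

theorem density_zero (hb : b.re ≠ 0) : density b 0 = 0 := by
  simp [density, hb]

theorem density_two_pi (hb : b.re ≠ 0) : density b (2 * Real.pi) = 0 := by
  simp [density, hb]

theorem measurable_density (b : ℂ) : Measurable (density b) := by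
  unfold density
  fun_prop

theorem intervalIntegrable_density (hb : -1 / 2 < b.re) :
    IntervalIntegrable (density b) volume 0 (2 * Real.pi) :=
  (intervalIntegrable_two_sin_half_rpow (by linarith)).continuousOn_mul
    (Continuous.continuousOn (by fun_prop))

theorem nu_exp_mul_I (b : ℂ) (hθ : θ ∈ Ioo 0 (2 * Real.pi)) :
    nu b (exp (θ * I)) = (density b θ : ℂ) := by
  have hsin := two_sin_half_pos hθ
  have hneg : -exp (θ * I) = exp ((θ - Real.pi : ℝ) * I) := by
    push_cast
    rw [sub_mul, exp_sub, exp_pi_mul_I, div_neg, div_one]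
  have hone : 1 - exp (θ * I) =
      (2 * Real.sin (θ / 2) : ℝ) * exp (((θ - Real.pi) / 2 : ℝ) * I) := by
    have hhalf : exp (((θ - Real.pi) / 2 : ℝ) * I) = exp (θ / 2 * I) * -I := by
      have hsub : (((θ - Real.pi) / 2 : ℝ) : ℂ) * I = θ / 2 * I - Real.pi / 2 * I := by
        push_cast
        ring
      rw [hsub, exp_sub, exp_pi_div_two_mul_I, div_eq_mul_inv, inv_I]
    rw [hhalf]
    linear_combination I * exp_half_mul_two_sin_half θ + (1 - exp (θ * I)) * I_mul_I
  have hlog_neg : log (-exp (θ * I)) = ((θ - Real.pi : ℝ) : ℂ) * I := by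
    rw [hneg, log_exp] <;> simp <;> linarith [hθ.1, hθ.2]
  have hlog_one : log (1 - exp (θ * I)) =
      (Real.log (2 * Real.sin (θ / 2)) : ℂ) + (((θ - Real.pi) / 2 : ℝ) : ℂ) * I := by
    rw [hone, log_ofReal_mul hsin (exp_ne_zero _), log_exp] <;> simp <;>
      linarith [hθ.1, hθ.2, Real.pi_pos]
  rw [nu, cpow_def_of_ne_zero (neg_ne_zero.mpr (exp_ne_zero _)), cpow_def_of_ne_zero
    (hone ▸ mul_ne_zero (ofReal_ne_zero.mpr hsin.ne') (exp_ne_zero _)), hlog_neg, hlog_one,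
    ← exp_add, density, Real.rpow_def_of_pos hsin, ← Real.exp_add, ofReal_exp]
  congr 1
  apply Complex.ext <;> simp <;> ring

/-- The measure `ν(z) dz / (i z)` on the circle, as the image of `density b θ dθ`. -/
def jacobiMeasure (b : ℂ) : Measure Circle :=
  ((volume.restrict (Ioo 0 (2 * Real.pi))).withDensity
    fun θ => ENNReal.ofReal (density b θ)).map Circle.exp

theorem integral_jacobiMeasure (b : ℂ) {f : Circle → ℂ} (hf : Continuous f) :
    ∫ t, f t ∂jacobiMeasure b =
      ∫ θ in (0 : ℝ)..2 * Real.pi, f (Circle.exp θ) * (density b θ : ℂ) := by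
  rw [jacobiMeasure, integral_map (by fun_prop) hf.aestronglyMeasurable,
    integral_withDensity_eq_integral_toReal_smul (measurable_density b).ennreal_ofReal
      (.of_forall fun _ => ENNReal.ofReal_lt_top),
    intervalIntegral.integral_of_le Real.two_pi_pos.le, integral_Ioc_eq_integral_Ioo]
  refine setIntegral_congr_fun measurableSet_Ioo fun θ hθ => ?_
  simp only [ENNReal.toReal_ofReal (density_pos b hθ).le, real_smul, mul_comm]

theorem circleIntegral_mul_nu (b : ℂ) {f : ℂ → ℂ} (hf : Continuous fun t : Circle => f t) :
    (∮ z in C(0, 1), f z * nu b z) = I * ∫ t : Circle, t * f t ∂jacobiMeasure b := by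
  have hcoe : Continuous fun t : Circle => (t : ℂ) := by fun_prop
  rw [integral_jacobiMeasure b (f := fun t => t * f t) (hcoe.mul hf), circleIntegral,
    ← intervalIntegral.integral_const_mul, intervalIntegral.integral_of_le Real.two_pi_pos.le,
    intervalIntegral.integral_of_le Real.two_pi_pos.le, integral_Ioc_eq_integral_Ioo,
    integral_Ioc_eq_integral_Ioo]
  refine setIntegral_congr_fun measurableSet_Ioo fun θ hθ => ?_
  simp only [deriv_circleMap, circleMap_zero, ofReal_one, one_mul, nu_exp_mul_I b hθ,
    smul_eq_mul, Circle.coe_exp]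
  ring

instance [hb : Fact (-1 / 2 < b.re)] : IsFiniteMeasure (jacobiMeasure b) :=
  have := isFiniteMeasure_withDensity_ofReal
    ((intervalIntegrable_iff_integrableOn_Ioo_of_le Real.two_pi_pos.le).mp
      (intervalIntegrable_density hb.out)).2
  Measure.isFiniteMeasure_map _ _

instance : IsNontrivialMeasure (jacobiMeasure b) where
  measure_compl_ne_zero s hs hzero := by
    rw [jacobiMeasure, Measure.map_apply (by fun_prop) hs.measurableSet.compl,
      withDensity_apply_eq_zero (measurable_density b).ennreal_ofReal,
      Measure.restrict_apply' measurableSet_Ioo] at hzero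
    have hcountable : (Circle.exp ⁻¹' s).Countable := by
      have hpreimage : Circle.exp ⁻¹' s = circleMap 0 1 ⁻¹' ((fun t : Circle => (t : ℂ)) '' s) := by
        ext θ
        rw [mem_preimage, mem_preimage, circleMap_zero, ofReal_one, one_mul, ← Circle.coe_exp]
        exact Circle.coe_injective.mem_set_image.symm
      rw [hpreimage]
      exact (hs.countable.image _).preimage_circleMap 0 one_ne_zero
    have hcover : Ioo 0 (2 * Real.pi) ⊆
        {θ | ENNReal.ofReal (density b θ) ≠ 0} ∩ Circle.exp ⁻¹' sᶜ ∩ Ioo 0 (2 * Real.pi) ∪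
          Circle.exp ⁻¹' s := by
      intro θ hθ
      by_cases hmem : Circle.exp θ ∈ s
      · exact Or.inr hmem
      · exact Or.inl ⟨⟨(ENNReal.ofReal_pos.mpr (density_pos b hθ)).ne', hmem⟩, hθ⟩
    have hnull := measure_mono_null hcover (measure_union_null hzero (hcountable.measure_zero _))
    rw [Real.volume_Ioo, sub_zero, ENNReal.ofReal_eq_zero] at hnull
    exact hnull.not_gt Real.two_pi_pos

theorem hasDerivAt_mul_density_add_half {g : ℂ → ℂ} {g₀ : ℂ}
    (hg : HasDerivAt g g₀ (exp (θ * I))) (hθ : θ ∈ Ioo 0 (2 * Real.pi)) :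
    HasDerivAt (fun x : ℝ => g (exp (x * I)) * (exp (x / 2 * I) * density (b + 1 / 2) x))
      (-(((1 - exp (θ * I)) * exp (θ * I) * g₀ -
        ((b + 1) * exp (θ * I) + conj b) * g (exp (θ * I))) * density b θ)) θ := by
  have hexp (c : ℂ) : HasDerivAt (fun x : ℝ => exp (x * c)) (exp (θ * c) * c) θ := by
    simpa using ((hasDerivAt_id θ).ofReal_comp.mul_const c).cexp
  have hexp_half : HasDerivAt (fun x : ℝ => exp (x / 2 * I)) (exp (θ / 2 * I) * (I / 2)) θ := by
    simpa only [div_mul_eq_mul_div, mul_div_assoc] using hexp (I / 2)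
  refine ((hg.comp θ (hexp I)).fun_mul
    (hexp_half.fun_mul (hasDerivAt_density_add_half b hθ).ofReal_comp)).congr_deriv ?_
  have hsin := exp_half_mul_two_sin_half θ
  have hcos := exp_half_mul_cos_half θ
  have hb : b = b.re + b.im * I := (re_add_im b).symm
  have hconj : conj b = b.re - b.im * I := by
    apply Complex.ext <;> simp
  rw [density_add_half b hθ]
  push_cast at hsin hcos ⊢
  simp only [Function.comp_apply]
  linear_combination (density b θ : ℂ) *
    ((g₀ * exp (θ * I) * I + g (exp (θ * I)) * (I / 2 - b.im)) * hsin +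
      g (exp (θ * I)) * (2 * b.re + 1) * hcos +
      (1 - exp (θ * I)) * (g₀ * exp (θ * I) + g (exp (θ * I)) / 2) * I_mul_I -
      g (exp (θ * I)) * (exp (θ * I) * hb + hconj))

theorem pearsonEquation_jacobiMeasure (b : ℂ) [hb : Fact (-1 / 2 < b.re)] :
    PearsonEquation b (jacobiMeasure b) := by
  intro g g' hg hg'
  have hcoe : Continuous fun t : Circle => (t : ℂ) := by fun_prop
  have hg_cont : Continuous fun t : Circle => g t :=
    continuous_iff_continuousAt.mpr fun t => (hg t).continuousAt.comp hcoe.continuousAt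
  have hcont : Continuous fun t : Circle =>
      (1 - (t : ℂ)) * t * g' t - ((b + 1) * t + conj b) * g t :=
    (((continuous_const.sub hcoe).mul hcoe).mul hg').sub
      (((continuous_const.mul hcoe).add continuous_const).mul hg_cont)
  have hb' : 0 < (b + 1 / 2).re := by
    norm_num
    linarith [hb.out]
  have hprimitive := intervalIntegral.integral_eq_sub_of_hasDerivAt_of_le Real.two_pi_pos.le
    (Continuous.continuousOn ?_)
    (fun θ hθ => hasDerivAt_mul_density_add_half (b := b)
      (Circle.coe_exp θ ▸ hg (Circle.exp θ)) hθ) ?_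
  · rw [integral_jacobiMeasure b hcont, ← neg_eq_zero, ← intervalIntegral.integral_neg]
    simpa only [Circle.coe_exp, density_zero hb'.ne', density_two_pi hb'.ne', ofReal_zero,
      mul_zero, sub_zero] using hprimitive
  · have hg_exp : Continuous fun x : ℝ => g (exp (x * I)) := by
      simpa only [Function.comp_def, Circle.coe_exp] using hg_cont.comp Circle.exp.continuous
    exact hg_exp.mul ((by fun_prop : Continuous fun x : ℝ => exp (x / 2 * I)).mul
      (continuous_ofReal.comp (continuous_density hb'.le)))
  · have hdensity := intervalIntegrable_density hb.out
    have hdensity_ofReal :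
        IntervalIntegrable (fun θ => (density b θ : ℂ)) volume 0 (2 * Real.pi) :=
      ⟨hdensity.1.ofReal, hdensity.2.ofReal⟩
    have hcont_exp := (hcont.comp Circle.exp.continuous).continuousOn (s := uIcc 0 (2 * Real.pi))
    simpa only [Function.comp_def, Circle.coe_exp, Pi.neg_def] using
      (hdensity_ofReal.continuousOn_mul hcont_exp).neg

end JacobiMeasure

section MonicOrthogonal

variable {b : ℂ}

theorem pairing_eq_circleInner [Fact (-1 / 2 < b.re)] (p q : ℂ[X]) :
    pairing b p q = circleInner (jacobiMeasure b) p q := by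
  have hcont : Continuous fun t : Circle =>
      p.eval (t : ℂ) * conj (q.eval (t : ℂ)) * (I * (t : ℂ))⁻¹ :=
    ((by fun_prop : Continuous fun t : Circle => p.eval (t : ℂ) * conj (q.eval (t : ℂ)))).mul
      (Continuous.inv₀ (by fun_prop) fun t => mul_ne_zero I_ne_zero t.coe_ne_zero)
  have hweight : ∀ t : ℂ, p.eval t * conj (q.eval t) * (nu b t / (I * t)) =
      p.eval t * conj (q.eval t) * (I * t)⁻¹ * nu b t := fun t => by ring
  simp only [pairing, hweight]
  rw [circleIntegral_mul_nu b hcont, ← integral_const_mul, circleInner_apply]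
  refine integral_congr_ae (.of_forall fun t => ?_)
  have ht := t.coe_ne_zero
  have hI := I_ne_zero
  field_simp

variable {Φ : ℕ → ℂ[X]} {κ : ℕ → ℝ}

theorem IsMonicOrthogonal.bconst_ne_zero (h : IsMonicOrthogonal b Φ κ) (n : ℕ) :
    bconst κ n ≠ 0 := by
  have := h.kappa_pos n
  rw [bconst, ofReal_ne_zero]
  positivity

variable [Fact (-1 / 2 < b.re)]

theorem IsMonicOrthogonal.isOrthogonalMonic (h : IsMonicOrthogonal b Φ κ) (n : ℕ) :
    IsOrthogonalMonic (jacobiMeasure b) n (Φ n) := by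
  refine ⟨h.monic n, h.natDegree_eq n, fun j => ?_⟩
  induction j using Nat.strong_induction_on with
  | _ j ih =>
    intro hj
    have hlower : circleInner (jacobiMeasure b) (Φ n) (Φ j - X ^ j) = 0 := by
      refine circleInner_eq_zero_of_coeff _ fun i hi => ?_
      have hi_le : i ≤ j := by
        by_contra! hlt
        simp [coeff_eq_zero_of_natDegree_lt ((h.natDegree_eq j).trans_lt hlt), coeff_X_pow,
          hlt.ne'] at hi
      have hi_ne : i ≠ j := by
        rintro rfl
        have hlead : (Φ i).coeff i = 1 := by
          simpa only [h.natDegree_eq] using (h.monic i).coeff_natDegree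
        simp [hlead] at hi
      exact ih i (lt_of_le_of_ne hi_le hi_ne) (hi_le.trans_lt hj)
    rwa [map_sub, ← pairing_eq_circleInner, h.orthogonal n j hj.ne', zero_sub, neg_eq_zero]
      at hlower

theorem isMonicOrthogonal_sqrt_inv_integral
    (hΦ : ∀ n, IsOrthogonalMonic (jacobiMeasure b) n (Φ n)) :
    IsMonicOrthogonal b Φ
      fun n => √(∫ t : Circle, ‖(Φ n).eval (t : ℂ)‖ ^ 2 ∂jacobiMeasure b)⁻¹ := by
  have hpos n := inv_pos.mpr (integral_norm_eval_sq_pos (jacobiMeasure b) (hΦ n).monic.ne_zero)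
  have hlt {n m : ℕ} (hmn : m < n) : circleInner (jacobiMeasure b) (Φ n) (Φ m) = 0 :=
    (hΦ n).circleInner_eq_zero ((hΦ m).natDegree_eq.trans_lt hmn)
  refine ⟨fun n => (hΦ n).monic, fun n => (hΦ n).natDegree_eq,
    fun n => Real.sqrt_pos.mpr (hpos n), fun n m hnm => ?_, fun n => ?_⟩
  · rw [pairing_eq_circleInner]
    rcases hnm.lt_or_gt with hlt_nm | hlt_mn
    · rw [← conj_circleInner, hlt hlt_nm, map_zero]
    · exact hlt hlt_mn
  · rw [pairing_eq_circleInner, circleInner_self, Real.sq_sqrt (hpos n).le, inv_inv]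

theorem IsMonicOrthogonal.unique {Ψ : ℕ → ℂ[X]} {τ : ℕ → ℝ} (h : IsMonicOrthogonal b Φ κ)
    (h' : IsMonicOrthogonal b Ψ τ) : Φ = Ψ ∧ κ = τ := by
  obtain rfl : Φ = Ψ := funext fun n => (h'.isOrthogonalMonic n).eq (h.isOrthogonalMonic n)
  refine ⟨rfl, funext fun n => ?_⟩
  have hsq := inv_injective (ofReal_injective ((h.norm_sq n).symm.trans (h'.norm_sq n)))
  exact (pow_left_inj₀ (h.kappa_pos n).le (h'.kappa_pos n).le two_ne_zero).mp hsq

theorem existsUnique_isMonicOrthogonal (b : ℂ) [Fact (-1 / 2 < b.re)] :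
    ∃! P : (ℕ → ℂ[X]) × (ℕ → ℝ), IsMonicOrthogonal b P.1 P.2 := by
  choose Φ hΦ using exists_isOrthogonalMonic (jacobiMeasure b)
  have h := isMonicOrthogonal_sqrt_inv_integral hΦ
  exact ⟨(Φ, _), h, fun _ h' => Prod.ext_iff.mpr (h'.unique h)⟩

namespace IsMonicOrthogonal

theorem bconst_mul_circleInner_self (h : IsMonicOrthogonal b Φ κ) (n : ℕ) :
    bconst κ n * circleInner (jacobiMeasure b) (Φ n) (Φ n) = 2 * Real.pi := by
  have hκ : (κ n : ℂ) ≠ 0 := ofReal_ne_zero.mpr (h.kappa_pos n).ne'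
  rw [← pairing_eq_circleInner, h.norm_sq, bconst]
  push_cast
  field_simp

theorem inv_bconst_succ_mul_bconst (h : IsMonicOrthogonal b Φ κ) (m : ℕ) :
    (bconst κ (m + 1))⁻¹ * bconst κ m = 1 - (‖alpha Φ m‖ : ℂ) ^ 2 := by
  have hm := h.bconst_mul_circleInner_self m
  have hsucc := h.bconst_mul_circleInner_self (m + 1)
  rw [circleInner_self_succ h.isOrthogonalMonic, ← hm] at hsucc
  have hne := h.bconst_ne_zero (m + 1)
  apply mul_right_cancel₀ (h.isOrthogonalMonic m).circleInner_self_ne_zero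
  field_simp
  linear_combination -hsucc

end IsMonicOrthogonal

end MonicOrthogonal

section RiemannHilbert

variable {b z : ℂ} {Φ : ℕ → ℂ[X]} {κ : ℕ → ℝ}

theorem circleIntegral_eval_div_sub (b : ℂ) (m : ℕ) (p : ℂ[X]) (hz : ‖z‖ ≠ 1) :
    (2 * Real.pi * I)⁻¹ * (∮ t in C(0, 1), p.eval t / (t - z) * (nu b t / t ^ (m + 1))) =
      (2 * Real.pi : ℂ)⁻¹ * cauchyTransform (jacobiMeasure b) m p z := by
  have hweight : ∀ t : ℂ, p.eval t / (t - z) * (nu b t / t ^ (m + 1)) =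
      p.eval t * (t ^ (m + 1))⁻¹ / (t - z) ^ 1 * nu b t := fun t => by ring
  simp only [hweight]
  rw [circleIntegral_mul_nu b
      (continuous_div_coe_circle_sub_pow (continuous_eval_mul_inv_pow p (m + 1)) hz 1),
    cauchyTransform, mul_inv, mul_assoc, inv_mul_cancel_left₀ I_ne_zero]
  congr 1
  refine integral_congr_ae (.of_forall fun t => ?_)
  have ht := t.coe_ne_zero
  simp only [pow_succ]
  field_simp

theorem G_succ_eq (b : ℂ) (Φ : ℕ → ℂ[X]) (m : ℕ) (hz : ‖z‖ ≠ 1) :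
    G b Φ (m + 1) z =
      (2 * Real.pi : ℂ)⁻¹ * cauchyTransform (jacobiMeasure b) m (Φ (m + 1)) z :=
  circleIntegral_eval_div_sub b m _ hz

theorem Gstar_eq (b : ℂ) (Φ : ℕ → ℂ[X]) (m : ℕ) (hz : ‖z‖ ≠ 1) :
    Gstar b Φ m z = (2 * Real.pi : ℂ)⁻¹ * cauchyTransform (jacobiMeasure b) m (recip Φ m) z :=
  circleIntegral_eval_div_sub b m _ hz

theorem eventually_norm_ne_one (hz : ‖z‖ ≠ 1) : ∀ᶠ w in nhds z, ‖w‖ ≠ 1 :=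
  continuous_norm.continuousAt.eventually_ne hz

variable [Fact (-1 / 2 < b.re)]

theorem hasDerivAt_G_succ (Φ : ℕ → ℂ[X]) (m : ℕ) (hz : ‖z‖ ≠ 1) :
    HasDerivAt (G b Φ (m + 1)) ((2 * Real.pi : ℂ)⁻¹ *
      deriv (cauchyTransform (jacobiMeasure b) m (Φ (m + 1))) z) z :=
  ((hasDerivAt_cauchyTransform m (Φ (m + 1)) hz).differentiableAt.hasDerivAt.const_mul
    _).congr_of_eventuallyEq ((eventually_norm_ne_one hz).mono fun _ => G_succ_eq b Φ m)

theorem hasDerivAt_Gstar (Φ : ℕ → ℂ[X]) (m : ℕ) (hz : ‖z‖ ≠ 1) :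
    HasDerivAt (Gstar b Φ m) ((2 * Real.pi : ℂ)⁻¹ *
      deriv (cauchyTransform (jacobiMeasure b) m (recip Φ m)) z) z :=
  ((hasDerivAt_cauchyTransform m (recip Φ m) hz).differentiableAt.hasDerivAt.const_mul
    _).congr_of_eventuallyEq ((eventually_norm_ne_one hz).mono fun _ => Gstar_eq b Φ m)

namespace IsMonicOrthogonal

theorem det_Y (h : IsMonicOrthogonal b Φ κ) (m : ℕ) (hz : ‖z‖ ≠ 1) :
    (Y b Φ κ (m + 1) z).det = 1 := by
  rw [Y, Matrix.det_fin_two_of, add_tsub_cancel_right, G_succ_eq b Φ m hz, Gstar_eq b Φ m hz]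
  have hwronskian := wronskian_cauchyTransform h.isOrthogonalMonic m hz
  have hnorm := h.bconst_mul_circleInner_self m
  have hpi : (2 * Real.pi : ℂ)⁻¹ * (2 * Real.pi) = 1 :=
    inv_mul_cancel₀ (by exact_mod_cast Real.two_pi_pos.ne')
  linear_combination -bconst κ m * (2 * Real.pi : ℂ)⁻¹ * hwronskian +
    (2 * Real.pi : ℂ)⁻¹ * hnorm + hpi

variable (h : IsMonicOrthogonal b Φ κ) (m : ℕ)
include h

theorem mul_eval_derivative (z : ℂ) :
    z * (1 - z) * (derivative (Φ (m + 1))).eval z =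
      (-(m + 1) * z + (conj b + (m + 1)) * (1 - (‖alpha Φ m‖ : ℂ) ^ 2)) * (Φ (m + 1)).eval z +
        (conj b + (m + 1)) * (1 - (‖alpha Φ m‖ : ℂ) ^ 2) * conj (alpha Φ m) *
          (recip Φ m).eval z := by
  have heval := congrArg (eval z)
    ((pearsonEquation_jacobiMeasure b).structure_relation h.isOrthogonalMonic m)
  simp only [eval_mul, eval_add, eval_sub, eval_X, eval_one, eval_C] at heval
  linear_combination heval

theorem mul_eval_derivative_recip (z : ℂ) :
    z * (1 - z) * (derivative (recip Φ m)).eval z =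
      (b * z + (conj b + (m + 1)) * (‖alpha Φ m‖ : ℂ) ^ 2) * (recip Φ m).eval z +
        (conj b + (m + 1)) * alpha Φ m * (Φ (m + 1)).eval z := by
  have heval := congrArg (eval z)
    ((pearsonEquation_jacobiMeasure b).structure_relation_recip h.isOrthogonalMonic m)
  simp only [eval_mul, eval_add, eval_sub, eval_X, eval_one, eval_C] at heval
  linear_combination heval

theorem mul_deriv_G (hz : ‖z‖ ≠ 1) :
    z * (1 - z) * deriv (G b Φ (m + 1)) z =
      (-b * z - (conj b + (m + 1)) * (‖alpha Φ m‖ : ℂ) ^ 2) * G b Φ (m + 1) z +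
        (conj b + (m + 1)) * (1 - (‖alpha Φ m‖ : ℂ) ^ 2) * conj (alpha Φ m) *
          Gstar b Φ m z := by
  rw [(hasDerivAt_G_succ Φ m hz).deriv, G_succ_eq b Φ m hz, Gstar_eq b Φ m hz]
  linear_combination (2 * Real.pi : ℂ)⁻¹ * (pearsonEquation_jacobiMeasure
    b).mul_deriv_cauchyTransform_succ h.isOrthogonalMonic m hz

theorem mul_deriv_Gstar (hz : ‖z‖ ≠ 1) :
    z * (1 - z) * deriv (Gstar b Φ m) z =
      ((m + 1) * z - (conj b + (m + 1)) * (1 - (‖alpha Φ m‖ : ℂ) ^ 2)) * Gstar b Φ m z +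
        (conj b + (m + 1)) * alpha Φ m * G b Φ (m + 1) z := by
  rw [(hasDerivAt_Gstar Φ m hz).deriv, G_succ_eq b Φ m hz, Gstar_eq b Φ m hz]
  linear_combination (2 * Real.pi : ℂ)⁻¹ * (pearsonEquation_jacobiMeasure
    b).mul_deriv_cauchyTransform_recip h.isOrthogonalMonic m hz

theorem coeff_succ_self :
    (Φ (m + 1)).coeff m = conj b - (conj b + (m + 1)) * (‖alpha Φ m‖ : ℂ) ^ 2 :=
  (pearsonEquation_jacobiMeasure b).coeff_succ_self h.isOrthogonalMonic m

theorem verblunsky_recurrence :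
    (conj b + (m + 1)) * alpha Φ m = (b + m) * alpha Φ ((m : ℤ) - 1) :=
  (pearsonEquation_jacobiMeasure b).verblunsky_recurrence h.isOrthogonalMonic m

theorem alpha_succ :
    alpha Φ (m + 1 : ℕ) = (b + (m + 1)) / (conj b + (m + 1) + 1) * alpha Φ m := by
  have hne : conj b + (m + 1) + 1 ≠ 0 := fun hzero => by
    have hre := congrArg re hzero
    simp at hre
    linarith [Fact.out (p := -1 / 2 < b.re), (Nat.cast_nonneg m : (0 : ℝ) ≤ m)]
  have hrec := h.verblunsky_recurrence (m + 1)
  push_cast at hrec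
  rw [add_sub_cancel_right] at hrec
  rw [div_mul_eq_mul_div, eq_div_iff hne]
  push_cast
  linear_combination hrec

theorem sub_one_mul_eval_derivative (z : ℂ) :
    (z - 1) * (derivative (Φ (m + 1))).eval z =
      -(conj b + (m + 1)) * (1 - (‖alpha Φ m‖ : ℂ) ^ 2) * (Φ m).eval z +
        (m + 1) * (Φ (m + 1)).eval z := by
  have heval := congrArg (eval z)
    ((pearsonEquation_jacobiMeasure b).X_sub_one_mul_derivative h.isOrthogonalMonic m)
  simp only [eval_mul, eval_add, eval_sub, eval_X, eval_one, eval_smul, smul_eq_mul] at heval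
  linear_combination heval

end IsMonicOrthogonal

end RiemannHilbert

section MatrixDerivative

variable {𝕜 l m n : Type*} [NontriviallyNormedField 𝕜] [Finite n]

theorem hasDerivAt_matrix {F : 𝕜 → Matrix l n 𝕜} {F' : Matrix l n 𝕜} {z : 𝕜} :
    HasDerivAt F F' z ↔ ∀ i j, HasDerivAt (fun w => F w i j) (F' i j) z := by
  have := Fintype.ofFinite n
  exact hasDerivAt_pi.trans (forall_congr' fun _ => hasDerivAt_pi)

theorem hasDerivAt_matrix_mul [Fintype m] {F : 𝕜 → Matrix l m 𝕜} {G : 𝕜 → Matrix m n 𝕜}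
    {F' : Matrix l m 𝕜} {G' : Matrix m n 𝕜} {z : 𝕜}
    (hF : HasDerivAt F F' z) (hG : HasDerivAt G G' z) :
    HasDerivAt (fun w => F w * G w) (F' * G z + F z * G') z := by
  rw [hasDerivAt_matrix] at hF hG ⊢
  intro i j
  simp only [Matrix.mul_apply, Matrix.add_apply, ← Finset.sum_add_distrib]
  exact HasDerivAt.fun_sum fun k _ => (hF i k).mul (hG k j)

end MatrixDerivative

section Branches

theorem hasDerivAt_of_sq_eventuallyEq {f g : ℂ → ℂ} {z l : ℂ} (hf : DifferentiableAt ℂ f z)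
    (hfg : (fun w => f w ^ 2) =ᶠ[nhds z] g) (hg : HasDerivAt g (g z * l) z) (hfz : f z ≠ 0) :
    HasDerivAt f (f z * (l / 2)) z := by
  have hderiv := (hf.hasDerivAt.fun_pow 2).unique (hg.congr_of_eventuallyEq hfg)
  rw [← hfg.eq_of_nhds] at hderiv
  refine hf.hasDerivAt.congr_deriv (mul_left_cancel₀ hfz ?_)
  norm_num at hderiv
  linear_combination hderiv / 2

theorem hasDerivAt_of_exp_eventuallyEq {f g : ℂ → ℂ} {z g' : ℂ} (hf : DifferentiableAt ℂ f z)
    (hfg : (fun w => exp (f w)) =ᶠ[nhds z] g) (hg : HasDerivAt g g' z) :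
    HasDerivAt f (g' / g z) z := by
  have hderiv := hf.hasDerivAt.cexp.unique (hg.congr_of_eventuallyEq hfg)
  refine hf.hasDerivAt.congr_deriv ?_
  rw [← hderiv, ← hfg.eq_of_nhds, mul_div_cancel_left₀ _ (exp_ne_zero _)]

namespace Branch

variable {b z : ℂ} {n : ℕ} {U : Set ℂ} (β : Branch b n U)

theorem ne_zero (β : Branch b n U) (hz : z ∈ U) : z ≠ 0 :=
  neg_ne_zero.mp (β.exp_logNeg z hz ▸ exp_ne_zero _)

theorem one_sub_ne_zero (β : Branch b n U) (hz : z ∈ U) : 1 - z ≠ 0 :=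
  β.exp_logOneSub z hz ▸ exp_ne_zero _

theorem sqrtNu_ne_zero (hz : z ∈ U) : β.sqrtNu z ≠ 0 :=
  ne_zero_pow two_ne_zero (β.sqrtNu_sq z hz ▸ exp_ne_zero _)

theorem powHalf_ne_zero (hz : z ∈ U) : β.powHalf z ≠ 0 :=
  ne_zero_pow two_ne_zero (β.powHalf_sq z hz ▸ pow_ne_zero n (β.ne_zero hz))

theorem det_C (hz : z ∈ U) : (β.C z).det = 1 := by
  rw [Branch.C, Matrix.det_fin_two_of, mul_zero, sub_zero,
    div_mul_div_cancel₀ (β.powHalf_ne_zero hz), div_self (β.sqrtNu_ne_zero hz)]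

theorem hasDerivAt_sqrtNu (hU : IsOpen U) (hz : z ∈ U) :
    HasDerivAt β.sqrtNu (β.sqrtNu z * ((-conj b / z - (b + conj b) / (1 - z)) / 2)) z := by
  have hmem := hU.mem_nhds hz
  have hz0 := β.ne_zero hz
  have hz1 := β.one_sub_ne_zero hz
  have hlogNeg : HasDerivAt β.logNeg (-1 / -z) z :=
    hasDerivAt_of_exp_eventuallyEq (β.logNeg_holo.differentiableAt hmem)
      (Filter.eventuallyEq_of_mem hmem β.exp_logNeg) (hasDerivAt_neg z)
  have hlogOneSub : HasDerivAt β.logOneSub (-1 / (1 - z)) z :=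
    hasDerivAt_of_exp_eventuallyEq (β.logOneSub_holo.differentiableAt hmem)
      (Filter.eventuallyEq_of_mem hmem β.exp_logOneSub) ((hasDerivAt_id z).const_sub 1)
  refine hasDerivAt_of_sq_eventuallyEq (β.sqrtNu_holo.differentiableAt hmem)
    (Filter.eventuallyEq_of_mem hmem β.sqrtNu_sq) ?_ (β.sqrtNu_ne_zero hz)
  refine ((hlogNeg.const_mul _).fun_add (hlogOneSub.const_mul _)).cexp.congr_deriv ?_
  congr 1
  field_simp
  ring

theorem hasDerivAt_powHalf (hU : IsOpen U) (hz : z ∈ U) :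
    HasDerivAt β.powHalf (β.powHalf z * (n / z / 2)) z := by
  have hmem := hU.mem_nhds hz
  have hz0 := β.ne_zero hz
  refine hasDerivAt_of_sq_eventuallyEq (β.powHalf_holo.differentiableAt hmem)
    (Filter.eventuallyEq_of_mem hmem β.powHalf_sq) ?_ (β.powHalf_ne_zero hz)
  refine (hasDerivAt_pow n z).congr_deriv ?_
  cases n with
  | zero => simp
  | succ n =>
    simp only [add_tsub_cancel_right]
    field_simp
    ring

end Branch

/-- The diagonal matrix `z (1 - z) C_n'(z) C_n(z)⁻¹`: it records the exponents of
`ν(z)^{1/2} z^{-n/2}` at `0`, `1` and `∞`, and does not depend on the branch. -/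
def exponentMatrix (b : ℂ) (n : ℕ) (z : ℂ) : Matrix (Fin 2) (Fin 2) ℂ :=
  !![((n - b) * z - (conj b + n)) / 2, 0; 0, -(((n - b) * z - (conj b + n)) / 2)]

theorem Branch.hasDerivAt_C {b z : ℂ} {n : ℕ} {U : Set ℂ} (β : Branch b n U) (hU : IsOpen U)
    (hz : z ∈ U) :
    HasDerivAt β.C ((z * (1 - z))⁻¹ • (exponentMatrix b n z * β.C z)) z := by
  have hz0 := β.ne_zero hz
  have hz1 := β.one_sub_ne_zero hz
  have hsqrtNu := β.sqrtNu_ne_zero hz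
  have hpowHalf := β.powHalf_ne_zero hz
  rw [hasDerivAt_matrix, Fin.forall_fin_two, Fin.forall_fin_two, Fin.forall_fin_two]
  simp only [Branch.C, exponentMatrix, Matrix.mul_fin_two, Matrix.smul_apply, Matrix.of_apply,
    Matrix.cons_val', Matrix.cons_val_zero, Matrix.cons_val_one, Matrix.cons_val_fin_one,
    smul_eq_mul, mul_zero, zero_mul, add_zero, zero_add]
  refine ⟨⟨?_, hasDerivAt_const z 0⟩, hasDerivAt_const z 0, ?_⟩
  · refine ((β.hasDerivAt_sqrtNu hU hz).fun_div (β.hasDerivAt_powHalf hU hz)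
      hpowHalf).congr_deriv ?_
    field_simp
    ring
  · refine ((β.hasDerivAt_powHalf hU hz).fun_div (β.hasDerivAt_sqrtNu hU hz)
      hsqrtNu).congr_deriv ?_
    field_simp
    ring

end Branches

section StructureMatrix

/-- The polynomial matrix `z (1 - z) M_{m+1}(z)`, i.e. the coefficient matrix of the linear system
`z (1 - z) Z' = S Z` satisfied by `Z_{m+1}`. -/
def structureMatrix (b : ℂ) (Φ : ℕ → ℂ[X]) (κ : ℕ → ℝ) (m : ℕ) (z : ℂ) :
    Matrix (Fin 2) (Fin 2) ℂ :=
  !![-((b + (m + 1)) * z + (conj b + (m + 1)) * (2 * ‖alpha Φ m‖ ^ 2 - 1)) / 2,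
      -(bconst κ (m + 1))⁻¹ * (conj b + (m + 1)) * conj (alpha Φ m);
     -bconst κ m * (conj b + (m + 1)) * alpha Φ m,
      ((b + (m + 1)) * z + (conj b + (m + 1)) * (2 * ‖alpha Φ m‖ ^ 2 - 1)) / 2]

namespace IsMonicOrthogonal

variable {b z : ℂ} [Fact (-1 / 2 < b.re)] {Φ : ℕ → ℂ[X]} {κ : ℕ → ℝ}
  (h : IsMonicOrthogonal b Φ κ) (m : ℕ)
include h

theorem hasDerivAt_Y (hz0 : z ≠ 0) (hz : ‖z‖ ≠ 1) :
    HasDerivAt (Y b Φ κ (m + 1)) ((z * (1 - z))⁻¹ • (structureMatrix b Φ κ m z *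
      Y b Φ κ (m + 1) z - Y b Φ κ (m + 1) z * exponentMatrix b (m + 1) z)) z := by
  have hz1 : 1 - z ≠ 0 := sub_ne_zero.mpr fun h1 => hz (by rw [← h1, norm_one])
  have hbconst := h.inv_bconst_succ_mul_bconst m
  rw [hasDerivAt_matrix, Fin.forall_fin_two, Fin.forall_fin_two, Fin.forall_fin_two]
  simp only [Y, structureMatrix, exponentMatrix, Matrix.mul_fin_two, Matrix.smul_apply,
    Matrix.sub_apply, Matrix.of_apply, Matrix.cons_val', Matrix.cons_val_zero,
    Matrix.cons_val_one, Matrix.cons_val_fin_one, smul_eq_mul, mul_zero, add_zero, zero_add,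
    add_tsub_cancel_right, Nat.cast_add, Nat.cast_one]
  refine ⟨⟨((Φ (m + 1)).hasDerivAt z).congr_deriv ?_,
    (hasDerivAt_G_succ Φ m hz).differentiableAt.hasDerivAt.congr_deriv ?_⟩,
    (((recip Φ m).hasDerivAt z).const_mul _).congr_deriv ?_,
    ((hasDerivAt_Gstar Φ m hz).differentiableAt.hasDerivAt.const_mul _).congr_deriv ?_⟩ <;>
    rw [eq_inv_mul_iff_mul_eq₀ (mul_ne_zero hz0 hz1)]
  · linear_combination h.mul_eval_derivative m z -
      (conj b + (m + 1)) * conj (alpha Φ m) * (recip Φ m).eval z * hbconst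
  · linear_combination h.mul_deriv_G m hz -
      (conj b + (m + 1)) * conj (alpha Φ m) * Gstar b Φ m z * hbconst
  · linear_combination -bconst κ m * h.mul_eval_derivative_recip m z
  · linear_combination -bconst κ m * h.mul_deriv_Gstar m hz

variable {U : Set ℂ} (hU : IsOpen U) (β : Branch b (m + 1) U)
include hU

theorem hasDerivAt_Z (hzU : z ∈ U) (hz : ‖z‖ ≠ 1) :
    HasDerivAt (Z β Φ κ)
      ((z * (1 - z))⁻¹ • (structureMatrix b Φ κ m z * Z β Φ κ z)) z := by
  have hmul := hasDerivAt_matrix_mul (h.hasDerivAt_Y m (β.ne_zero hzU) hz)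
    (β.hasDerivAt_C hU hzU)
  rwa [smul_mul_assoc, mul_smul_comm, ← smul_add, sub_mul, Matrix.mul_assoc, Matrix.mul_assoc,
    sub_add_cancel] at hmul

theorem smul_M (hzU : z ∈ U) (hz : ‖z‖ ≠ 1) :
    (z * (1 - z)) • M β Φ κ z = structureMatrix b Φ κ m z := by
  have hdet : IsUnit (Z β Φ κ z).det := by
    rw [Z, Matrix.det_mul, h.det_Y m hz, β.det_C hzU, one_mul]
    exact isUnit_one
  have hderiv : (Matrix.of fun i j => deriv (fun w => Z β Φ κ w i j) z) =
      (z * (1 - z))⁻¹ • (structureMatrix b Φ κ m z * Z β Φ κ z) :=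
    Matrix.ext fun i j => (hasDerivAt_matrix.mp (h.hasDerivAt_Z m hU β hzU hz) i j).deriv
  rw [M, hderiv, smul_mul_assoc, Matrix.mul_nonsing_inv_cancel_right _ _ hdet,
    smul_inv_smul₀ (mul_ne_zero (β.ne_zero hzU) (β.one_sub_ne_zero hzU))]

end IsMonicOrthogonal

theorem IsMonicOrthogonal.structureMatrix_eq {b : ℂ} [Fact (-1 / 2 < b.re)] {Φ : ℕ → ℂ[X]}
    {κ : ℕ → ℝ} (h : IsMonicOrthogonal b Φ κ) (m : ℕ) (z : ℂ) :
    structureMatrix b Φ κ m z =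
      !![-((b + (m + 1)) * z + (conj b - (m + 1))) / 2 + (Φ (m + 1)).coeff m,
          -(b + (m + 1) + 1) * (bconst κ (m + 1))⁻¹ * conj (alpha Φ (m + 1 : ℕ));
         -(b + (m + 1) - 1) * bconst κ m * alpha Φ ((m : ℤ) - 1),
          ((b + (m + 1)) * z + (conj b - (m + 1))) / 2 - (Φ (m + 1)).coeff m] := by
  have hrec := h.verblunsky_recurrence m
  have hrec_succ := congrArg conj (h.verblunsky_recurrence (m + 1))
  simp only [map_mul, map_add, Complex.conj_conj, map_natCast, map_one, Nat.cast_add,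
    Nat.cast_one, add_sub_cancel_right] at hrec_succ
  have hdiag : ((b + (m + 1)) * z + (conj b + (m + 1)) * (2 * ‖alpha Φ m‖ ^ 2 - 1)) / 2 =
      ((b + (m + 1)) * z + (conj b - (m + 1))) / 2 - (Φ (m + 1)).coeff m := by
    rw [h.coeff_succ_self m]
    ring
  have hupper : -(bconst κ (m + 1))⁻¹ * (conj b + (m + 1)) * conj (alpha Φ m) =
      -(b + (m + 1) + 1) * (bconst κ (m + 1))⁻¹ * conj (alpha Φ (m + 1 : ℕ)) := by
    push_cast
    linear_combination (bconst κ (m + 1))⁻¹ * hrec_succ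
  have hlower : -bconst κ m * (conj b + (m + 1)) * alpha Φ m =
      -(b + (m + 1) - 1) * bconst κ m * alpha Φ ((m : ℤ) - 1) := by
    linear_combination -bconst κ m * hrec
  rw [structureMatrix, neg_div, hdiag, hupper, hlower, neg_div, neg_sub', sub_neg_eq_add]

end StructureMatrix

end JacobiOPUC

end

open JacobiOPUC Polynomial ComplexConjugate in
theorem mainTheorem11 (b : ℂ) (hb : -1 / 2 < b.re) :
    -- the monic orthogonal polynomials exist and are unique
    (∃! P : (ℕ → ℂ[X]) × (ℕ → ℝ), IsMonicOrthogonal b P.1 P.2) ∧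
    ∀ (Φ : ℕ → ℂ[X]) (κ : ℕ → ℝ), IsMonicOrthogonal b Φ κ → ∀ n : ℕ, 1 ≤ n →
      -- `Y_n` is holomorphic off the unit circle, with determinant 1
      DifferentiableOn ℂ (G b Φ n) {z | ‖z‖ ≠ 1} ∧
      DifferentiableOn ℂ (Gstar b Φ (n - 1)) {z | ‖z‖ ≠ 1} ∧
      (∀ z : ℂ, ‖z‖ ≠ 1 → (Y b Φ κ n z).det = 1) ∧
      -- the two representations of `z (1 - z) M_n`, for all local branches
      (∀ U : Set ℂ, IsOpen U → (∀ z ∈ U, ‖z‖ ≠ 1) → ∀ β : Branch b n U, ∀ z ∈ U,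
        (z * (1 - z)) • M β Φ κ z =
          !![-((b + n) * z + (conj b + n) * (2 * ‖alpha Φ (n - 1)‖ ^ 2 - 1)) / 2,
              -(bconst κ n)⁻¹ * (conj b + n) * conj (alpha Φ (n - 1));
             -bconst κ (n - 1) * (conj b + n) * alpha Φ (n - 1),
              ((b + n) * z + (conj b + n) * (2 * ‖alpha Φ (n - 1)‖ ^ 2 - 1)) / 2] ∧
        (z * (1 - z)) • M β Φ κ z =
          !![-((b + n) * z + (conj b - n)) / 2 + (Φ n).coeff (n - 1),
              -(b + n + 1) * (bconst κ n)⁻¹ * conj (alpha Φ n);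
             -(b + n - 1) * bconst κ (n - 1) * alpha Φ (n - 2),
              ((b + n) * z + (conj b - n)) / 2 - (Φ n).coeff (n - 1)]) ∧
      -- the consequences of comparing them
      (Φ n).coeff (n - 1) = conj b - (conj b + n) * ‖alpha Φ (n - 1)‖ ^ 2 ∧
      alpha Φ n = (b + n) / (conj b + n + 1) * alpha Φ (n - 1) ∧
      -- first-order differential relations
      (∀ z : ℂ, z * (1 - z) * (derivative (Φ n)).eval z =
        (-n * z + (conj b + n) * (1 - ‖alpha Φ (n - 1)‖ ^ 2)) * (Φ n).eval z +
          (conj b + n) * (1 - ‖alpha Φ (n - 1)‖ ^ 2) * conj (alpha Φ (n - 1)) *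
            (recip Φ (n - 1)).eval z) ∧
      (∀ z : ℂ, ‖z‖ ≠ 1 → z * (1 - z) * deriv (G b Φ n) z =
        (-b * z - (conj b + n) * ‖alpha Φ (n - 1)‖ ^ 2) * G b Φ n z +
          (conj b + n) * (1 - ‖alpha Φ (n - 1)‖ ^ 2) * conj (alpha Φ (n - 1)) *
            Gstar b Φ (n - 1) z) ∧
      (∀ z : ℂ, z * (1 - z) * (derivative (recip Φ (n - 1))).eval z =
        (b * z + (conj b + n) * ‖alpha Φ (n - 1)‖ ^ 2) * (recip Φ (n - 1)).eval z +
          (conj b + n) * alpha Φ (n - 1) * (Φ n).eval z) ∧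
      (∀ z : ℂ, ‖z‖ ≠ 1 → z * (1 - z) * deriv (Gstar b Φ (n - 1)) z =
        (n * z - (conj b + n) * (1 - ‖alpha Φ (n - 1)‖ ^ 2)) * Gstar b Φ (n - 1) z +
          (conj b + n) * alpha Φ (n - 1) * G b Φ n z) ∧
      (∀ z : ℂ, (z - 1) * (derivative (Φ n)).eval z =
        -(conj b + n) * (1 - ‖alpha Φ (n - 1)‖ ^ 2) * (Φ (n - 1)).eval z +
          n * (Φ n).eval z) := by
  have := Fact.mk hb
  refine ⟨existsUnique_isMonicOrthogonal b, fun Φ κ h n hn => ?_⟩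
  obtain ⟨m, rfl⟩ := Nat.exists_eq_add_of_le' hn
  have hpred : ((m + 1 : ℕ) : ℤ) - 1 = m := by push_cast; ring
  have hpred_two : ((m + 1 : ℕ) : ℤ) - 2 = m - 1 := by push_cast; ring
  have hcast : ((m + 1 : ℕ) : ℂ) = m + 1 := Nat.cast_succ m
  rw [hpred, hpred_two, hcast, add_tsub_cancel_right]
  exact ⟨fun z hz => (hasDerivAt_G_succ Φ m hz).differentiableAt.differentiableWithinAt,
    fun z hz => (hasDerivAt_Gstar Φ m hz).differentiableAt.differentiableWithinAt,
    fun z hz => h.det_Y m hz,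
    fun U hU hUT β z hz => ⟨h.smul_M m hU β hz (hUT z hz),
      (h.smul_M m hU β hz (hUT z hz)).trans (h.structureMatrix_eq m z)⟩,
    h.coeff_succ_self m, h.alpha_succ m, h.mul_eval_derivative m, fun z hz => h.mul_deriv_G m hz,
    h.mul_eval_derivative_recip m, fun z hz => h.mul_deriv_Gstar m hz,
    h.sub_one_mul_eval_derivative m⟩
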